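/- **Conventions.** Let $Z$ be a topological space and $Y\subset Z$. $K(Z,Y)$ is the set of classes $[E_0,E_1,a]$ of triples consisting of complex vector bundles $E_0,E_1$ over $Z$ (of locally constant finite rank) and a bundle morphism $a:E_0\to E_1$ whose support $\{z : a_z \text{ is not an isomorphism}\}$ is a compact subset of $Z\setminus Y$. Two triples $\xi,\xi'$ are equivalent if there are triples $\eta_0,\eta_1$ with empty support such that $\xi\oplus\eta_0$ and $\xi'\oplus\eta_1$ are homotopic, i.e. isomorphic to the restrictions to $Z\times\{0\}$ and $Z\times\{1\}$ of one such triple on $(Z\times[0,1],Y\times[0,1])$. Set $K^{-1}(X,Y)=K(X\times\mathbb R,Y\times\mathbb R)$. Let $T:Z\to\mathcal L(W,F)$ be a norm continuous family of Fredholm operators of index $0$ between Banach spaces, invertible on $Y$ and outside a compact subset of $Z$. Then $\operatorname{ind}(T)=[E(T,V),Z\times V,T|_{E(T,V)}]\in K(Z,Y)$, where $V\subset F$ is any finite dimensional subspace with $\operatorname{im}T_z+V=F$ for all $z$, and $E(T,V)\subset Z\times W$ is the bundle with fibres $\{u\in W: T_zu\in V\}$ (the class does not depend on $V$). Let $W,H$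 be complex Hilbert spaces with a continuous dense injection $W\hookrightarrow H$, $X$ a compact space, $Y\subset X$ closed. A *selfadjoint Fredholm family* $D:X\to\mathcal L(W,H)$, invertible on $Y$, is a norm continuous family of Fredholm operators which are selfadjoint as operators in $H$ with domain $W$ and are invertible for $\lambda\in Y$. Its index bundle is $\operatorname{s-ind}(D)=\operatorname{ind}(\overline D)\in K^{-1}(X,Y)$, with $\overline D_{(\lambda,s)}=D_\lambda+is$ for $(\lambda,s)\in X\times\mathbb R$. **Theorem.** Let $W\subset E\subset H$ be complex Hilbert spaces such that $W\hookrightarrow E$ is continuous with dense image, $E\hookrightarrow H$ is compact, and $W$ is dense in $H$. Let $K:H\to E$ be given by $\langle u,v\rangle_H=\langle Ku,v\rangle_E$ for $u\in H$, $v\in E$, let $K_0=K|_E$, and assume $W\subset\operatorname{im}K$. Let $X$ be a compact space, $Y\subset X$ closed, and $D:X\to\mathcal L(W,H)$ a selfadjoint Fredholm family, invertible on $Y$, such that for some $C>0$ $$|\langle D_\lambda u,v\rangle_H|\le C\|u\|_E\|v\|_E,\qquad u,v\in W,\ \lambda\in X.$$ Let $B_\lambda$ be the bounded operators on $E$ representing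 the unique bounded extensions to $E$ of the forms $\langle D_\lambda u,v\rangle_H$, i.e. $\langle B_\lambda u,v\rangle_E=\langle D_\lambda u,v\rangle_H$ for $u,v\in W$. Assume that $\lambda\mapsto B_\lambda$ is a norm continuous family of Fredholm operators on $E$ and that $$\ker(B_\lambda+is\,K_0)\subset W,\qquad(\lambda,s)\in X\times\mathbb R.$$ Then $B$ is a selfadjoint Fredholm family on $E$ (with domain $E$), invertible on $Y$, and $$\operatorname{s-ind}(D)=\operatorname{s-ind}(B)\in K^{-1}(X,Y).$$ -/

import Mathlib

open Topology Bundle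

universe u v

namespace IndexBundle

/-! ### Complex vector bundles and bundle morphisms -/

/-- A complex vector bundle over `Z`: a family of complex vector spaces with a topology on the
total space which is locally isomorphic, linearly on the fibres, to `U × ℂⁿ`.
The rank `n` may depend on the point (so it is only locally constant). -/
structure CBundle (Z : Type v) [TopologicalSpace Z] where
  Fiber : Z → Type u
  [addCommGroup : ∀ z, AddCommGroup (Fiber z)]
  [module : ∀ z, Module ℂ (Fiber z)]
  [topTotal : TopologicalSpace (TotalSpace Unit Fiber)]
  locallyTrivial : ∀ z₀ : Z, ∃ (n : ℕ)
    (e : Trivialization (Fin n → ℂ) (TotalSpace.proj : TotalSpace Unit Fiber → Z)),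
    z₀ ∈ e.baseSet ∧
      ∀ z ∈ e.baseSet, IsLinearMap ℂ (fun u : Fiber z => (e ⟨z, u⟩).2)

attribute [instance] CBundle.addCommGroup CBundle.module CBundle.topTotal

section

variable {Z : Type v} [TopologicalSpace Z]

/-- The total space of a bundle. -/
abbrev CBundle.Total (E : CBundle.{u} Z) : Type (max u v) := TotalSpace Unit E.Fiber

/-- A criterion for local triviality: local trivialisations with an arbitrary finite dimensional
normed space as model fibre, given by fibrewise inverse linear maps. -/
theorem exists_trivialization {Fiber : Z → Type u} [∀ z, AddCommGroup (Fiber z)]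
    [∀ z, Module ℂ (Fiber z)] [TopologicalSpace (TotalSpace Unit Fiber)]
    (hproj : Continuous (TotalSpace.proj : TotalSpace Unit Fiber → Z))
    {F : Type*} [NormedAddCommGroup F] [NormedSpace ℂ F] [FiniteDimensional ℂ F]
    {U : Set Z} (hU : IsOpen U) (φ : ∀ z, Fiber z →ₗ[ℂ] F) (ψ : ∀ z, F → Fiber z)
    (hl : ∀ z ∈ U, ∀ u, ψ z (φ z u) = u) (hr : ∀ z ∈ U, ∀ f, φ z (ψ z f) = f)
    (hφ : ContinuousOn (fun p : TotalSpace Unit Fiber => φ p.proj p.2) (TotalSpace.proj ⁻¹' U))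
    (hψ : ContinuousOn (fun q : Z × F => (⟨q.1, ψ q.1 q.2⟩ : TotalSpace Unit Fiber))
      (U ×ˢ Set.univ))
    (z₀ : Z) (hz₀ : z₀ ∈ U) :
    ∃ (n : ℕ) (e : Trivialization (Fin n → ℂ) (TotalSpace.proj : TotalSpace Unit Fiber → Z)),
      z₀ ∈ e.baseSet ∧ ∀ z ∈ e.baseSet, IsLinearMap ℂ (fun u : Fiber z => (e ⟨z, u⟩).2) := by
  let c : F ≃L[ℂ] (Fin (Module.finrank ℂ F) → ℂ) :=
    ContinuousLinearEquiv.ofFinrankEq (by simp)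
  refine ⟨Module.finrank ℂ F,
    { toFun := fun p => (p.proj, c (φ p.proj p.2))
      invFun := fun q => ⟨q.1, ψ q.1 (c.symm q.2)⟩
      source := TotalSpace.proj ⁻¹' U
      target := U ×ˢ Set.univ
      map_source' := fun p hp => ⟨hp, trivial⟩
      map_target' := fun q hq => hq.1
      left_inv' := ?_
      right_inv' := ?_
      open_source := hU.preimage hproj
      open_target := hU.prod isOpen_univ
      continuousOn_toFun := ?_
      continuousOn_invFun := ?_
      baseSet := U
      open_baseSet := hU
      source_eq := rfl
      target_eq := rfl
      proj_toFun := fun p _ => rfl }, hz₀, ?_⟩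
  · rintro ⟨z, u⟩ hz
    simp [hl z hz u]
  · rintro ⟨z, f⟩ hz
    simp [hr z hz.1]
  · exact hproj.continuousOn.prodMk (c.continuous.comp_continuousOn hφ)
  · refine hψ.comp (f := fun q : Z × (Fin (Module.finrank ℂ F) → ℂ) => (q.1, c.symm q.2))
      (by fun_prop) ?_
    rintro ⟨z, f⟩ hz
    exact ⟨hz.1, trivial⟩
  · intro z _
    exact (c.toLinearMap.comp (φ z)).isLinear

/-- A morphism of vector bundles over the identity of `Z`. -/
structure CBundle.Hom (E E' : CBundle.{u} Z) where
  map : ∀ z, E.Fiber z →ₗ[ℂ] E'.Fiber z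
  continuous_map : Continuous (fun p : E.Total => (⟨p.proj, map p.proj p.2⟩ : E'.Total))

/-- An isomorphism of vector bundles over the identity of `Z`. -/
structure CBundle.Iso (E E' : CBundle.{u} Z) where
  equiv : ∀ z, E.Fiber z ≃ₗ[ℂ] E'.Fiber z
  continuous_equiv : Continuous (fun p : E.Total => (⟨p.proj, equiv p.proj p.2⟩ : E'.Total))
  continuous_symm :
    Continuous (fun p : E'.Total => (⟨p.proj, (equiv p.proj).symm p.2⟩ : E.Total))

theorem CBundle.continuous_proj (E : CBundle.{u} Z) :
    Continuous (TotalSpace.proj : E.Total → Z) := by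
  rw [continuous_iff_continuousAt]
  intro p
  obtain ⟨n, e, he, -⟩ := E.locallyTrivial p.proj
  exact e.continuousAt_proj (e.mem_source.2 he)

/-- Local triviality in terms of fibrewise inverse linear maps. -/
theorem CBundle.exists_local (E : CBundle.{u} Z) (z₀ : Z) :
    ∃ (n : ℕ) (U : Set Z) (φ : ∀ z, E.Fiber z →ₗ[ℂ] (Fin n → ℂ))
      (ψ : ∀ z, (Fin n → ℂ) → E.Fiber z), IsOpen U ∧ z₀ ∈ U ∧
      (∀ z ∈ U, ∀ u, ψ z (φ z u) = u) ∧ (∀ z ∈ U, ∀ f, φ z (ψ z f) = f) ∧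
      ContinuousOn (fun p : E.Total => φ p.proj p.2) (TotalSpace.proj ⁻¹' U) ∧
      ContinuousOn (fun q : Z × (Fin n → ℂ) => (⟨q.1, ψ q.1 q.2⟩ : E.Total))
        (U ×ˢ Set.univ) := by
  classical
  obtain ⟨n, e, he, hlin⟩ := E.locallyTrivial z₀
  have hfst : ∀ z ∈ e.baseSet, ∀ u : E.Fiber z, (e ⟨z, u⟩).1 = z := fun z hz u =>
    e.coe_fst (e.mem_source.2 hz)
  have hsurj : ∀ z ∈ e.baseSet, ∀ f, ∃ u : E.Fiber z, (e ⟨z, u⟩).2 = f := by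
    intro z hz f
    have h1 : e.toOpenPartialHomeomorph.symm (z, f) ∈ e.source :=
      e.map_target (e.mem_target.2 hz)
    have h2 : e (e.toOpenPartialHomeomorph.symm (z, f)) = (z, f) :=
      e.apply_symm_apply (e.mem_target.2 hz)
    have h3 : (e.toOpenPartialHomeomorph.symm (z, f)).proj = z :=
      e.proj_symm_apply (e.mem_target.2 hz)
    generalize e.toOpenPartialHomeomorph.symm (z, f) = p at h1 h2 h3
    obtain ⟨z', u⟩ := p
    subst h3
    exact ⟨u, by rw [h2]⟩
  choose g hg using hsurj
  have hginv : ∀ z (hz : z ∈ e.baseSet) f,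
      (⟨z, g z hz f⟩ : E.Total) = e.toOpenPartialHomeomorph.symm (z, f) := by
    intro z hz f
    have h1 : e ⟨z, g z hz f⟩ = (z, f) := Prod.ext (hfst z hz _) (hg z hz f)
    rw [← h1]
    exact (e.toOpenPartialHomeomorph.left_inv (e.mem_source.2 hz)).symm
  refine ⟨n, e.baseSet, fun z => if h : z ∈ e.baseSet then (hlin z h).mk' _ else 0,
    fun z f => if h : z ∈ e.baseSet then g z h f else 0,
    e.open_baseSet, he, ?_, ?_, ?_, ?_⟩
  · intro z hz u
    simp only [hz, dif_pos, IsLinearMap.mk'_apply]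
    have h1 : (⟨z, g z hz (e ⟨z, u⟩).2⟩ : E.Total) = ⟨z, u⟩ := by
      rw [hginv]
      have h2 : (z, (e ⟨z, u⟩).2) = e ⟨z, u⟩ := Prod.ext (hfst z hz u).symm rfl
      rw [h2]
      exact e.toOpenPartialHomeomorph.left_inv (e.mem_source.2 hz)
    exact eq_of_heq (TotalSpace.mk.inj h1).2
  · intro z hz f
    simp only [hz, dif_pos, IsLinearMap.mk'_apply]
    exact hg z hz f
  · have h := e.toOpenPartialHomeomorph.continuousOn
    rw [e.source_eq] at h
    refine (continuous_snd.comp_continuousOn h).congr ?_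
    intro p hp
    have hp' : p.proj ∈ e.baseSet := hp
    simp [hp']
  · have h := e.toOpenPartialHomeomorph.continuousOn_symm
    rw [e.target_eq] at h
    refine h.congr ?_
    rintro ⟨z, f⟩ hz
    have hz' : z ∈ e.baseSet := hz.1
    simp only [hz', dif_pos]
    exact hginv z hz' f

/-! ### Product bundle, direct sum, pullback -/

/-- The product bundle with fibre `V`. -/
def CBundle.product (Z : Type v) [TopologicalSpace Z] (V : Type u) [NormedAddCommGroup V]
    [NormedSpace ℂ V] [FiniteDimensional ℂ V] : CBundle.{u} Z :=
  letI : TopologicalSpace (TotalSpace Unit (fun _ : Z => V)) :=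
    TopologicalSpace.induced (fun p => ((p.proj, p.2) : Z × V)) inferInstance
  { Fiber := fun _ => V
    locallyTrivial := by
      intro z₀
      have hc : Continuous (fun p : TotalSpace Unit (fun _ : Z => V) => ((p.proj, p.2) : Z × V)) :=
        continuous_induced_dom
      refine exists_trivialization (continuous_fst.comp hc) isOpen_univ (fun _ => LinearMap.id)
        (fun _ f => f) (fun _ _ _ => rfl) (fun _ _ _ => rfl)
        (continuous_snd.comp hc).continuousOn ?_ z₀ trivial
      refine (continuous_induced_rng.2 ?_).continuousOn
      exact continuous_id }

/-- The direct sum of two bundles. The total space is the fibre product of the total spaces. -/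
def CBundle.directSum (E E' : CBundle.{u} Z) : CBundle.{u} Z :=
  letI : TopologicalSpace (TotalSpace Unit (fun z => E.Fiber z × E'.Fiber z)) :=
    TopologicalSpace.induced
      (fun p => ((⟨p.proj, p.2.1⟩, ⟨p.proj, p.2.2⟩) : E.Total × E'.Total)) inferInstance
  { Fiber := fun z => E.Fiber z × E'.Fiber z
    locallyTrivial := by
      intro z₀
      have hc : Continuous (fun p : TotalSpace Unit (fun z => E.Fiber z × E'.Fiber z) =>
        ((⟨p.proj, p.2.1⟩, ⟨p.proj, p.2.2⟩) : E.Total × E'.Total)) := continuous_induced_dom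
      obtain ⟨n, U, φ, ψ, hU, hz, hl, hr, hφ, hψ⟩ := E.exists_local z₀
      obtain ⟨n', U', φ', ψ', hU', hz', hl', hr', hφ', hψ'⟩ := E'.exists_local z₀
      have hp : Continuous (TotalSpace.proj :
          TotalSpace Unit (fun z => E.Fiber z × E'.Fiber z) → Z) :=
        E.continuous_proj.comp (continuous_fst.comp hc)
      refine exists_trivialization (F := (Fin n → ℂ) × (Fin n' → ℂ)) hp (hU.inter hU')
        (fun z => (φ z).prodMap (φ' z)) (fun z f => (ψ z f.1, ψ' z f.2)) ?_ ?_ ?_ ?_ z₀ ⟨hz, hz'⟩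
      · rintro z ⟨h, h'⟩ ⟨a, b⟩
        simp [hl z h, hl' z h']
      · rintro z ⟨h, h'⟩ ⟨a, b⟩
        simp [hr z h, hr' z h']
      · exact (hφ.comp (continuous_fst.comp hc).continuousOn (fun p hp => hp.1)).prodMk
          (hφ'.comp (continuous_snd.comp hc).continuousOn (fun p hp => hp.2))
      · rw [continuousOn_iff_continuous_domRestrict]
        refine continuous_induced_rng.2 ?_
        refine Continuous.prodMk ?_ ?_
        · exact continuousOn_iff_continuous_domRestrict.1
            (hψ.comp (f := fun q : Z × ((Fin n → ℂ) × (Fin n' → ℂ)) => (q.1, q.2.1))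
              (by fun_prop) (fun q hq => ⟨hq.1.1, trivial⟩))
        · exact continuousOn_iff_continuous_domRestrict.1
            (hψ'.comp (f := fun q : Z × ((Fin n → ℂ) × (Fin n' → ℂ)) => (q.1, q.2.2))
              (by fun_prop) (fun q hq => ⟨hq.1.2, trivial⟩)) }

/-- The pullback of a bundle along a continuous map. -/
def CBundle.pullback {Z' : Type v} [TopologicalSpace Z'] (f : C(Z', Z)) (E : CBundle.{u} Z) :
    CBundle.{u} Z' :=
  letI : TopologicalSpace (TotalSpace Unit (fun z => E.Fiber (f z))) :=
    TopologicalSpace.induced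
      (fun p => ((p.proj, ⟨f p.proj, p.2⟩) : Z' × E.Total)) inferInstance
  { Fiber := fun z => E.Fiber (f z)
    locallyTrivial := by
      intro z₀
      have hc : Continuous (fun p : TotalSpace Unit (fun z => E.Fiber (f z)) =>
        ((p.proj, ⟨f p.proj, p.2⟩) : Z' × E.Total)) := continuous_induced_dom
      obtain ⟨n, U, φ, ψ, hU, hz, hl, hr, hφ, hψ⟩ := E.exists_local (f z₀)
      refine exists_trivialization (continuous_fst.comp hc) (hU.preimage f.continuous)
        (fun z => φ (f z)) (fun z => ψ (f z)) (fun z h => hl _ h) (fun z h => hr _ h) ?_ ?_ z₀ hz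
      · exact hφ.comp (continuous_snd.comp hc).continuousOn (fun p hp => hp)
      · rw [continuousOn_iff_continuous_domRestrict]
        refine continuous_induced_rng.2 ?_
        refine Continuous.prodMk ?_ ?_
        · exact continuous_fst.comp continuous_subtype_val
        · exact continuousOn_iff_continuous_domRestrict.1
            (hψ.comp (f := fun q : Z' × (Fin n → ℂ) => (f q.1, q.2))
              (by fun_prop) (fun q hq => ⟨hq.1, trivial⟩)) }

/-- The direct sum of two morphisms. -/
def CBundle.Hom.directSum {E₀ E₁ E₀' E₁' : CBundle.{u} Z} (a : E₀.Hom E₁) (a' : E₀'.Hom E₁') :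
    (E₀.directSum E₀').Hom (E₁.directSum E₁') where
  map z := (a.map z).prodMap (a'.map z)
  continuous_map := by
    have hc : Continuous (fun p : (E₀.directSum E₀').Total =>
        ((⟨p.proj, p.2.1⟩, ⟨p.proj, p.2.2⟩) : E₀.Total × E₀'.Total)) := continuous_induced_dom
    exact continuous_induced_rng.2 ((a.continuous_map.comp (continuous_fst.comp hc)).prodMk
      (a'.continuous_map.comp (continuous_snd.comp hc)))

/-- The pullback of a morphism. -/
def CBundle.Hom.pullback {Z' : Type v} [TopologicalSpace Z'] (f : C(Z', Z))
    {E₀ E₁ : CBundle.{u} Z} (a : E₀.Hom E₁) : (E₀.pullback f).Hom (E₁.pullback f) where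
  map z := a.map (f z)
  continuous_map := by
    have hc : Continuous (fun p : (E₀.pullback f).Total =>
        ((p.proj, ⟨f p.proj, p.2⟩) : Z' × E₀.Total)) := continuous_induced_dom
    exact continuous_induced_rng.2 ((continuous_fst.comp hc).prodMk
      (a.continuous_map.comp (continuous_snd.comp hc)))

/-! ### Relative K-theory -/

/-- A triple `{E₀, E₁, a}` of two vector bundles and a morphism between them. -/
structure Triple (Z : Type v) [TopologicalSpace Z] where
  E₀ : CBundle.{u} Z
  E₁ : CBundle.{u} Z
  a : E₀.Hom E₁

namespace Triple

/-- The support: the set of points at which the morphism is not an isomorphism. -/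
def supp (ξ : Triple.{u} Z) : Set Z := {z | ¬ Function.Bijective (ξ.a.map z)}

/-- A triple is trivial if its support is empty. -/
def IsTrivial (ξ : Triple.{u} Z) : Prop := ξ.supp = ∅

/-- Isomorphism of triples. -/
def Isomorphic (ξ η : Triple.{u} Z) : Prop :=
  ∃ (φ₀ : ξ.E₀.Iso η.E₀) (φ₁ : ξ.E₁.Iso η.E₁),
    ∀ z u, η.a.map z (φ₀.equiv z u) = φ₁.equiv z (ξ.a.map z u)

/-- The direct sum of two triples. -/
def directSum (ξ η : Triple.{u} Z) : Triple.{u} Z :=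
  ⟨ξ.E₀.directSum η.E₀, ξ.E₁.directSum η.E₁, ξ.a.directSum η.a⟩

/-- The pullback of a triple along a continuous map. -/
def pullback {Z' : Type v} [TopologicalSpace Z'] (f : C(Z', Z)) (ξ : Triple.{u} Z) :
    Triple.{u} Z' :=
  ⟨ξ.E₀.pullback f, ξ.E₁.pullback f, ξ.a.pullback f⟩

/-- The triples whose support is a compact subset of the complement of `Y`. -/
def IsAdmissible (Y : Set Z) (ξ : Triple.{u} Z) : Prop :=
  IsCompact ξ.supp ∧ ξ.supp ⊆ Yᶜ

/-- The inclusion of `Z` into `Z × [0,1]` as `Z × {t}`. -/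
def slice (Z : Type v) [TopologicalSpace Z] (t : unitInterval) : C(Z, Z × unitInterval) :=
  ⟨fun z => (z, t), by fun_prop⟩

/-- Homotopy of triples, through admissible triples on `(Z × [0,1], Y × [0,1])`. -/
def Homotopic (Y : Set Z) (ξ η : Triple.{u} Z) : Prop :=
  ∃ h : Triple.{u} (Z × unitInterval), IsAdmissible (Y ×ˢ Set.univ) h ∧
    Isomorphic (h.pullback (slice Z 0)) ξ ∧ Isomorphic (h.pullback (slice Z 1)) η

end Triple

/-- The set `L(Z, Y)` of admissible triples. -/
def L (Z : Type v) [TopologicalSpace Z] (Y : Set Z) : Type (max (u + 1) v) :=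
  {ξ : Triple.{u} Z // ξ.IsAdmissible Y}

/-- Stable homotopy of admissible triples: `ξ ⊕ η₀ ≃ ξ' ⊕ η₁` with trivial `η₀`, `η₁`. -/
def StablyHomotopic (Y : Set Z) (ξ ξ' : L.{u} Z Y) : Prop :=
  ∃ η₀ η₁ : Triple.{u} Z, η₀.IsTrivial ∧ η₁.IsTrivial ∧
    Triple.Homotopic Y (ξ.1.directSum η₀) (ξ'.1.directSum η₁)

end

/-- The relative K-theory `K(Z, Y)`: the set of classes of admissible triples under (the
equivalence relation generated by) stable homotopy. -/
def K (Z : Type v) [TopologicalSpace Z] (Y : Set Z) : Type (max (u + 1) v) :=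
  Quot (StablyHomotopic.{u} (Z := Z) Y)

/-- The class `[E₀, E₁, a]` of an admissible triple. -/
def K.mk {Z : Type v} [TopologicalSpace Z] {Y : Set Z} (ξ : L.{u} Z Y) : K.{u} Z Y :=
  Quot.mk _ ξ

/-- The odd K-theory `K⁻¹(X, Y) = K(X × ℝ, Y × ℝ)`. -/
abbrev KOdd (X : Type v) [TopologicalSpace X] (Y : Set X) : Type (max (u + 1) v) :=
  K.{u} (X × ℝ) (Y ×ˢ Set.univ)

/-! ### The index bundle of a Fredholm morphism between product bundles -/

section Fredholm

variable {Z : Type v} [TopologicalSpace Z]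
variable {W F : Type u} [NormedAddCommGroup W] [NormedSpace ℂ W]
  [NormedAddCommGroup F] [NormedSpace ℂ F]

/-- A norm continuous family of Fredholm operators of index zero, invertible outside a compact
set and on `Y`. -/
structure IsFredholmMorphism (Y : Set Z) (T : Z → W →L[ℂ] F) : Prop where
  continuous : Continuous T
  fredholm : ∀ z, (T z).IsFredholm
  index_zero : ∀ z, (T z).toLinearMap.index = 0
  invertible_off_compact : ∃ C : Set Z, IsCompact C ∧ ∀ z, z ∉ C → (T z).IsInvertible
  invertible_on : ∀ z ∈ Y, (T z).IsInvertible

/-- Transversality of a subspace `V` to the images of the family `T`. -/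
def IsTransversal (T : Z → W →L[ℂ] F) (V : Submodule ℂ F) : Prop :=
  ∀ z, LinearMap.range (T z).toLinearMap ⊔ V = ⊤

/-- The fibre `{u | T u ∈ V}` is finite dimensional. -/
theorem finiteDimensional_comap {T : W →L[ℂ] F} (hT : T.IsFredholm) (V : Submodule ℂ F)
    [FiniteDimensional ℂ V] : FiniteDimensional ℂ (V.comap T.toLinearMap) := by
  have := hT.finite_ker
  rw [← Submodule.fg_iff_finiteDimensional]
  refine Submodule.fg_of_fg_map_of_fg_inf_ker T.toLinearMap ?_ ?_
  · rw [Submodule.fg_iff_finiteDimensional]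
    exact Submodule.finiteDimensional_of_le (S₂ := V) (Submodule.map_comap_le _ _)
  · rw [Submodule.fg_iff_finiteDimensional]
    exact Submodule.finiteDimensional_of_le (S₂ := LinearMap.ker T.toLinearMap) inf_le_right

/-- The auxiliary operator `(u, v) ↦ (T u - v, P u)`. -/
noncomputable def auxOp (V : Submodule ℂ F) {N : Submodule ℂ W} (P : W →L[ℂ] N) (T : W →L[ℂ] F) :
    W × V →L[ℂ] F × N :=
  ((T.comp (ContinuousLinearMap.fst ℂ W V)) -
    V.subtypeL.comp (ContinuousLinearMap.snd ℂ W V)).prod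
    (P.comp (ContinuousLinearMap.fst ℂ W V))

@[simp] theorem auxOp_apply (V : Submodule ℂ F) {N : Submodule ℂ W} (P : W →L[ℂ] N)
    (T : W →L[ℂ] F) (p : W × V) : auxOp V P T p = (T p.1 - p.2, P p.1) := rfl

variable [CompleteSpace W] [CompleteSpace F]

/-- If `V` is transversal to the image of `T z₀`, the auxiliary operators are invertible near
`z₀`. -/
theorem exists_auxOp {T : Z → W →L[ℂ] F} (hc : Continuous T) (z₀ : Z) (hT : (T z₀).IsFredholm)
    (V : Submodule ℂ F) [FiniteDimensional ℂ V]
    (hV : LinearMap.range (T z₀).toLinearMap ⊔ V = ⊤) :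
    ∃ (P : W →L[ℂ] V.comap (T z₀).toLinearMap) (U : Set Z), IsOpen U ∧ z₀ ∈ U ∧
      Continuous (fun z => auxOp V P (T z)) ∧ ∀ z ∈ U, (auxOp V P (T z)).IsInvertible := by
  have := finiteDimensional_comap hT V
  obtain ⟨P, hP⟩ := Submodule.ClosedComplemented.of_finiteDimensional
    (V.comap (T z₀).toLinearMap)
  have hcont : Continuous (fun z => auxOp V P (T z)) := by
    have h1 : Continuous (fun z => (T z).comp (ContinuousLinearMap.fst ℂ W V) -
        V.subtypeL.comp (ContinuousLinearMap.snd ℂ W V)) :=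
      (hc.clm_comp continuous_const).sub continuous_const
    exact (ContinuousLinearMap.prodₗᵢ ℂ).continuous.comp (h1.prodMk
      (continuous_const (y := P.comp (ContinuousLinearMap.fst ℂ W V))))
  refine ⟨P, {z | (auxOp V P (T z)).IsInvertible}, ?_, ?_, hcont, fun z hz => hz⟩
  · exact (ContinuousLinearEquiv.isOpen (𝕜 := ℂ) (E := W × V)
      (F := F × V.comap (T z₀).toLinearMap)).preimage hcont
  · have hb : Function.Bijective (auxOp V P (T z₀)) := by
      constructor
      · rw [injective_iff_map_eq_zero]
        rintro ⟨u, v⟩ h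
        simp only [auxOp_apply, Prod.mk_eq_zero] at h
        obtain ⟨h1, h2⟩ := h
        have hu : u ∈ V.comap (T z₀).toLinearMap := by
          simp only [Submodule.mem_comap]
          have : (T z₀) u = v := sub_eq_zero.1 h1
          rw [ContinuousLinearMap.coe_coe, this]
          exact v.2
        have h3 := hP ⟨u, hu⟩
        simp only [h2] at h3
        have hu0 : u = 0 := by simpa using (congrArg Subtype.val h3).symm
        subst hu0
        have : v = 0 := by
          ext
          simpa using h1
        simp [this]
      · rintro ⟨f, k⟩
        have hf : f ∈ LinearMap.range (T z₀).toLinearMap ⊔ V := hV ▸ Submodule.mem_top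
        obtain ⟨_, ⟨u, rfl⟩, v, hv, rfl⟩ := Submodule.mem_sup.1 hf
        let e : V.comap (T z₀).toLinearMap := k - P u
        have he : (T z₀) (e : W) ∈ V := e.2
        refine ⟨(u + e, ⟨(T z₀) (e : W), he⟩ - ⟨v, hv⟩), ?_⟩
        simp only [auxOp_apply, map_add, Prod.mk.injEq]
        constructor
        · simp only [Submodule.coe_sub, ContinuousLinearMap.coe_coe]
          abel
        · rw [hP e]
          simp [e]
    exact ⟨ContinuousLinearEquiv.ofBijective _ (LinearMap.ker_eq_bot.2 hb.1)
      (LinearMap.range_eq_top.2 hb.2), by ext <;> rfl⟩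

/-- Existence of a finite dimensional transversal subspace. -/
theorem exists_transversal {Y : Set Z} {T : Z → W →L[ℂ] F} (hT : IsFredholmMorphism Y T) :
    ∃ V : Submodule ℂ F, FiniteDimensional ℂ V ∧ IsTransversal T V := by
  obtain ⟨C, hC, hinv⟩ := hT.invertible_off_compact
  have key : ∃ V : Submodule ℂ F, FiniteDimensional ℂ V ∧
      ∀ z ∈ C, LinearMap.range (T z).toLinearMap ⊔ V = ⊤ := by
    refine hC.induction_on (p := fun s => ∃ V : Submodule ℂ F, FiniteDimensional ℂ V ∧
      ∀ z ∈ s, LinearMap.range (T z).toLinearMap ⊔ V = ⊤) ?_ ?_ ?_ ?_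
    · exact ⟨⊥, inferInstance, by simp⟩
    · rintro s t hst ⟨V, hV, h⟩
      exact ⟨V, hV, fun z hz => h z (hst hz)⟩
    · rintro s t ⟨V, hV, h⟩ ⟨V', hV', h'⟩
      refine ⟨V ⊔ V', inferInstance, ?_⟩
      rintro z (hz | hz)
      · rw [← sup_assoc, h z hz, top_sup_eq]
      · rw [sup_comm V, ← sup_assoc, h' z hz, top_sup_eq]
    · intro z _
      obtain ⟨V, hV⟩ := (LinearMap.range (T z).toLinearMap).exists_isCompl
      have hfin : FiniteDimensional ℂ V :=
        Submodule.fg_iff_finiteDimensional _ |>.1 (Submodule.CoFG.fg_of_isCompl hV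
          (hT.fredholm z).finite_coker)
      obtain ⟨P, U, hU, hz, -, hinv⟩ :=
        exists_auxOp hT.continuous z (hT.fredholm z) V hV.sup_eq_top
      refine ⟨U, mem_nhdsWithin_of_mem_nhds (hU.mem_nhds hz), V, hfin, ?_⟩
      intro y hy
      rw [eq_top_iff]
      intro f _
      obtain ⟨⟨u, v⟩, huv⟩ := (hinv y hy).surjective (f, 0)
      simp only [auxOp_apply, Prod.mk.injEq] at huv
      exact Submodule.mem_sup.2 ⟨T y u, ⟨u, rfl⟩, -v, V.neg_mem v.2, by
        rw [← sub_eq_add_neg]; exact huv.1⟩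
  obtain ⟨V, hV, h⟩ := key
  refine ⟨V, hV, fun z => ?_⟩
  by_cases hz : z ∈ C
  · exact h z hz
  · rw [LinearMap.range_eq_top.2 (hinv z hz).surjective, top_sup_eq]

/-- The bundle `E(T, V)` with fibres `{u ∈ W | T_z u ∈ V}`, topologised as a subspace of
`Z × W`. -/
def kernelBundle {Y : Set Z} {T : Z → W →L[ℂ] F} (hT : IsFredholmMorphism Y T)
    (V : Submodule ℂ F) [FiniteDimensional ℂ V] (hV : IsTransversal T V) : CBundle.{u} Z :=
  letI : TopologicalSpace (TotalSpace Unit (fun z => V.comap (T z).toLinearMap)) :=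
    TopologicalSpace.induced (fun p => ((p.proj, (p.2 : W)) : Z × W)) inferInstance
  { Fiber := fun z => V.comap (T z).toLinearMap
    locallyTrivial := by
      intro z₀
      have hc : Continuous (fun p : TotalSpace Unit (fun z => V.comap (T z).toLinearMap) =>
        ((p.proj, (p.2 : W)) : Z × W)) := continuous_induced_dom
      have := finiteDimensional_comap (hT.fredholm z₀) V
      obtain ⟨P, U, hU, hz, hcont, hinv⟩ :=
        exists_auxOp hT.continuous z₀ (hT.fredholm z₀) V (hV z₀)
      classical
      have hmem : ∀ z ∈ U, ∀ f, ((auxOp V P (T z)).inverse (0, f)).1 ∈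
          V.comap (T z).toLinearMap := by
        intro z hz f
        have h := (hinv z hz).self_apply_inverse (0, f)
        simp only [auxOp_apply, Prod.mk.injEq] at h
        rw [Submodule.mem_comap, ContinuousLinearMap.coe_coe, sub_eq_zero.1 h.1]
        exact Subtype.property _
      refine exists_trivialization (continuous_fst.comp hc) hU
        (fun z => P.toLinearMap.comp (Submodule.subtype _))
        (fun z f => if hz : z ∈ U then ⟨((auxOp V P (T z)).inverse (0, f)).1, hmem z hz f⟩ else 0)
        ?_ ?_ ?_ ?_ z₀ hz
      · rintro z hz ⟨u, hu⟩
        simp only [hz, dif_pos]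
        ext
        have h := (hinv z hz).inverse_apply_self (u, ⟨T z u, hu⟩)
        simp only [auxOp_apply, sub_self] at h
        change ((auxOp V P (T z)).inverse (0, P u)).1 = u
        rw [h]
      · intro z hz f
        simp only [hz, dif_pos]
        have h := (hinv z hz).self_apply_inverse (0, f)
        simp only [auxOp_apply, Prod.mk.injEq] at h
        exact h.2
      · exact (P.continuous.comp (continuous_snd.comp hc)).continuousOn
      · rw [continuousOn_iff_continuous_domRestrict]
        refine continuous_induced_rng.2 ?_
        refine Continuous.prodMk (continuous_fst.comp continuous_subtype_val) ?_
        have hI : ContinuousOn (fun z => (auxOp V P (T z)).inverse) U := by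
          intro z hz
          refine ContinuousAt.continuousWithinAt ?_
          exact ((hinv z hz).contDiffAt_map_inverse (n := 0)).continuousAt.comp
            (f := fun z => auxOp V P (T z)) hcont.continuousAt
        have hI' : ContinuousOn (fun q : Z × V.comap (T z₀).toLinearMap =>
            ((auxOp V P (T q.1)).inverse (0, q.2)).1) (U ×ˢ Set.univ) := by
          refine continuous_fst.comp_continuousOn ?_
          refine ContinuousOn.clm_apply ?_ (by fun_prop)
          exact hI.comp continuous_fst.continuousOn (fun q hq => hq.1)
        refine (continuousOn_iff_continuous_domRestrict.1 hI').congr ?_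
        rintro ⟨⟨z, f⟩, hz⟩
        have hz' : z ∈ U := hz.1
        simp [hz'] }

/-- The triple `{E(T, V), Θ(V), T|E(T, V)}`. -/
noncomputable def indexTriple {Y : Set Z} {T : Z → W →L[ℂ] F} (hT : IsFredholmMorphism Y T)
    (V : Submodule ℂ F) [FiniteDimensional ℂ V] (hV : IsTransversal T V) : Triple.{u} Z where
  E₀ := kernelBundle hT V hV
  E₁ := CBundle.product Z V
  a :=
    { map := fun z => (T z).toLinearMap.restrict (p := V.comap (T z).toLinearMap) (q := V)
        (fun _ hu => hu)
      continuous_map := by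
        have hc : Continuous (fun p : (kernelBundle hT V hV).Total =>
          ((p.proj, p.2.1) : Z × W)) := continuous_induced_dom
        refine continuous_induced_rng.2 ?_
        refine Continuous.prodMk (continuous_fst.comp hc) ?_
        refine Continuous.subtype_mk ?_ _
        exact (hT.continuous.comp (continuous_fst.comp hc)).clm_apply (continuous_snd.comp hc) }

/-- The support of the index triple is the set of points where `T` is not invertible. -/
theorem supp_indexTriple {Y : Set Z} {T : Z → W →L[ℂ] F} (hT : IsFredholmMorphism Y T)
    (V : Submodule ℂ F) [FiniteDimensional ℂ V] (hV : IsTransversal T V) :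
    (indexTriple hT V hV).supp = {z | ¬ (T z).IsInvertible} := by
  ext z
  refine not_congr ⟨fun h => ?_, fun h => ?_⟩
  · have hb : Function.Bijective (T z) := by
      constructor
      · rw [injective_iff_map_eq_zero]
        intro u hu
        have hm : u ∈ V.comap (T z).toLinearMap := by
          simp [hu]
        have h0 : (⟨u, hm⟩ : V.comap (T z).toLinearMap) = 0 := h.1 (by
          exact (Subtype.ext hu : (⟨T z u, hm⟩ : V) = 0).trans (map_zero _).symm)
        exact congrArg Subtype.val h0
      · intro f
        have hf : f ∈ LinearMap.range (T z).toLinearMap ⊔ V := hV z ▸ Submodule.mem_top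
        obtain ⟨_, ⟨u, rfl⟩, v, hv, rfl⟩ := Submodule.mem_sup.1 hf
        obtain ⟨w, hw⟩ := h.2 ⟨v, hv⟩
        have hw' : (T z) w.1 = v := congrArg Subtype.val hw
        exact ⟨u + w.1, by simp [hw']⟩
    exact ⟨ContinuousLinearEquiv.ofBijective _ (LinearMap.ker_eq_bot.2 hb.1)
      (LinearMap.range_eq_top.2 hb.2), by ext; rfl⟩
  · constructor
    · rintro ⟨u, hu⟩ ⟨w, hw⟩ huw
      exact Subtype.ext (h.injective (congrArg Subtype.val huw))
    · rintro ⟨v, hv⟩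
      obtain ⟨u, hu⟩ := h.surjective v
      exact ⟨⟨u, by simpa [hu] using hv⟩, Subtype.ext hu⟩

theorem indexTriple_isAdmissible {Y : Set Z} {T : Z → W →L[ℂ] F} (hT : IsFredholmMorphism Y T)
    (V : Submodule ℂ F) [FiniteDimensional ℂ V] (hV : IsTransversal T V) :
    (indexTriple hT V hV).IsAdmissible Y := by
  rw [Triple.IsAdmissible, supp_indexTriple]
  obtain ⟨C, hC, hinv⟩ := hT.invertible_off_compact
  constructor
  · refine hC.of_isClosed_subset ?_ (fun z hz => by_contra fun h => hz (hinv z h))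
    exact ((ContinuousLinearEquiv.isOpen (𝕜 := ℂ) (E := W) (F := F)).preimage
      hT.continuous).isClosed_compl
  · exact fun z hz hY => hz (hT.invertible_on z hY)

/-- The class `[E(T, V), Θ(V), T|E(T, V)]` in `K(Z, Y)`. -/
noncomputable def indexClass {Y : Set Z} {T : Z → W →L[ℂ] F} (hT : IsFredholmMorphism Y T)
    (V : Submodule ℂ F) [FiniteDimensional ℂ V] (hV : IsTransversal T V) : K.{u} Z Y :=
  K.mk ⟨indexTriple hT V hV, indexTriple_isAdmissible hT V hV⟩

/-- The index bundle `ind(T) ∈ K(Z, Y)`, formed with some finite dimensional transversal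
subspace. -/
noncomputable def ind {Y : Set Z} {T : Z → W →L[ℂ] F} (hT : IsFredholmMorphism Y T) :
    K.{u} Z Y :=
  haveI := (exists_transversal hT).choose_spec.1
  indexClass hT (exists_transversal hT).choose (exists_transversal hT).choose_spec.2

end Fredholm

/-! ### Selfadjoint Fredholm families and their index bundle -/

section Selfadjoint

variable {X : Type v} [TopologicalSpace X]
variable {W H : Type u} [NormedAddCommGroup W] [InnerProductSpace ℂ W]
  [NormedAddCommGroup H] [InnerProductSpace ℂ H]

/-- For an injection `k : W → H`, a bounded operator `A : W → H` regarded as an (in general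
unbounded) operator in `H` with domain `k(W)`. -/
noncomputable def toUnbounded (k : W →L[ℂ] H) (hk : Function.Injective k) (A : W →L[ℂ] H) :
    H →ₗ.[ℂ] H where
  domain := LinearMap.range k.toLinearMap
  toFun := A.toLinearMap.comp (LinearEquiv.ofInjective k.toLinearMap hk).symm.toLinearMap

theorem mem_graph_toUnbounded {k : W →L[ℂ] H} {hk : Function.Injective k} {A : W →L[ℂ] H}
    {x y : H} : (x, y) ∈ (toUnbounded k hk A).graph ↔ ∃ w, k w = x ∧ A w = y := by
  rw [LinearPMap.mem_graph_iff]
  constructor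
  · rintro ⟨⟨_, ⟨w, rfl⟩⟩, h1, h2⟩
    refine ⟨w, h1, ?_⟩
    refine Eq.trans ?_ h2
    have : (LinearEquiv.ofInjective k.toLinearMap hk).symm ⟨k.toLinearMap w, ⟨w, rfl⟩⟩ = w :=
      (LinearEquiv.symm_apply_eq _).2 rfl
    exact congrArg A this.symm
  · rintro ⟨w, rfl, rfl⟩
    refine ⟨⟨k w, ⟨w, rfl⟩⟩, rfl, ?_⟩
    have : (LinearEquiv.ofInjective k.toLinearMap hk).symm ⟨k.toLinearMap w, ⟨w, rfl⟩⟩ = w :=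
      (LinearEquiv.symm_apply_eq _).2 rfl
    change A ((LinearEquiv.ofInjective k.toLinearMap hk).symm _) = A w
    exact congrArg A this

variable [CompleteSpace H]

/-- A norm continuous family `D` of Fredholm operators in `L(W, H)` which are selfadjoint as
operators in `H` with the dense domain `k(W)`, and which are invertible on `Y`. -/
structure IsSelfadjointFredholmFamily (k : W →L[ℂ] H) (Y : Set X) (D : X → W →L[ℂ] H) : Prop where
  injective : Function.Injective k
  denseRange : DenseRange k
  continuous : Continuous D
  selfadjoint : ∀ x, IsSelfAdjoint (toUnbounded k injective (D x))
  fredholm : ∀ x, (D x).IsFredholm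
  invertible_on : ∀ x ∈ Y, (D x).IsInvertible

/-- The suspension `(x, s) ↦ D x + i s`. -/
noncomputable def suspension (k : W →L[ℂ] H) (D : X → W →L[ℂ] H) (z : X × ℝ) : W →L[ℂ] H :=
  D z.1 + (Complex.I * (z.2 : ℂ)) • k

theorem graph_of_selfadjoint {k : W →L[ℂ] H} {hk : Function.Injective k} {A : W →L[ℂ] H}
    (hA : IsSelfAdjoint (toUnbounded k hk A)) (x y : H) :
    (∃ w, k w = x ∧ A w = y) ↔ ∀ w, inner ℂ y (k w) = inner ℂ x (A w) := by
  have hd : Dense ((toUnbounded k hk A).domain : Set H) := hA.dense_domain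
  have h1 := LinearPMap.adjoint_graph_eq_graph_adjoint hd
  rw [LinearPMap.isSelfAdjoint_def.1 hA] at h1
  rw [← mem_graph_toUnbounded (hk := hk), h1, Submodule.mem_adjoint_iff]
  constructor
  · intro h w
    have h2 := h (k w) (A w) (mem_graph_toUnbounded.2 ⟨w, rfl, rfl⟩)
    rw [← inner_conj_symm, ← inner_conj_symm x]
    exact congrArg _ (sub_eq_zero.1 h2).symm
  · intro h a b hab
    obtain ⟨w, rfl, rfl⟩ := mem_graph_toUnbounded.1 hab
    rw [← inner_conj_symm, ← inner_conj_symm (k w), h w, sub_self]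

theorem symm_of_selfadjoint {k : W →L[ℂ] H} {hk : Function.Injective k} {A : W →L[ℂ] H}
    (hA : IsSelfAdjoint (toUnbounded k hk A)) (u w : W) :
    inner ℂ (A u) (k w) = inner ℂ (k u) (A w) :=
  (graph_of_selfadjoint hA (k u) (A u)).1 ⟨u, rfl, rfl⟩ w

theorem norm_sq_of_selfadjoint {k : W →L[ℂ] H} {hk : Function.Injective k} {A : W →L[ℂ] H}
    (hA : IsSelfAdjoint (toUnbounded k hk A)) (s : ℝ) (u : W) :
    ‖A u + (Complex.I * (s : ℂ)) • k u‖ ^ 2 = ‖A u‖ ^ 2 + s ^ 2 * ‖k u‖ ^ 2 := by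
  have him : (inner ℂ (A u) (k u)).im = 0 := by
    have h := symm_of_selfadjoint hA u u
    rw [← inner_conj_symm (k u)] at h
    exact Complex.conj_eq_iff_im.1 h.symm
  rw [norm_add_sq (𝕜 := ℂ), inner_smul_right, norm_smul]
  simp [him, mul_pow]

theorem invertible_of_selfadjoint [CompleteSpace W] {k : W →L[ℂ] H} {hk : Function.Injective k} {A : W →L[ℂ] H}
    (hA : IsSelfAdjoint (toUnbounded k hk A)) {s : ℝ} (hs : s ≠ 0) :
    (A + (Complex.I * (s : ℂ)) • k).IsInvertible := by
  have hs2 : 0 < s ^ 2 := by positivity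
  have hnorm := norm_sq_of_selfadjoint hA
  have hzero : ∀ t : ℝ, t ≠ 0 → ∀ u, A u + (Complex.I * (t : ℂ)) • k u = 0 → u = 0 := by
    intro t ht u hu
    have h := hnorm t u
    rw [hu, norm_zero] at h
    have ht2 : 0 < t ^ 2 := by positivity
    have h2 : ‖k u‖ ^ 2 = 0 := by nlinarith [sq_nonneg ‖A u‖, sq_nonneg ‖k u‖]
    have h3 : k u = 0 := by simpa using h2
    exact hk (h3.trans (map_zero k).symm)
  have hcl : IsClosed (Set.range (k.prod A)) := by
    have : Set.range (k.prod A) =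
        {p : H × H | ∀ w, inner ℂ p.2 (k w) = inner ℂ p.1 (A w)} := by
      ext ⟨x, y⟩
      rw [Set.mem_ofPred_eq, ← graph_of_selfadjoint hA x y]
      simp
    rw [this, Set.ofPred_forall]
    exact isClosed_iInter fun w => isClosed_eq (by fun_prop) (by fun_prop)
  have hinj : Function.Injective (k.prod A) := fun a b h => hk (congrArg Prod.fst h)
  obtain ⟨c, hc⟩ := (k.prod A).antilipschitz_of_injective_of_isClosed_range hinj hcl
  let S : W →L[ℂ] H := A + (Complex.I * (s : ℂ)) • k
  have hSn : ∀ u, ‖S u‖ ^ 2 = ‖A u‖ ^ 2 + s ^ 2 * ‖k u‖ ^ 2 := hnorm s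
  have hS : AntilipschitzWith (c * (1 + ‖s‖₊⁻¹)) S := by
    refine AddMonoidHomClass.antilipschitz_of_bound S fun u => ?_
    have h1 : ‖u‖ ≤ c * ‖(k.prod A) u‖ :=
      ZeroHomClass.bound_of_antilipschitz (k.prod A) hc u
    have hs' : 0 < |s| := abs_pos.2 hs
    have h2 : ‖A u‖ ≤ ‖S u‖ := by
      refine abs_le_of_sq_le_sq' ?_ (norm_nonneg _) |>.2
      nlinarith [hSn u, mul_nonneg hs2.le (sq_nonneg ‖k u‖)]
    have h3 : |s| * ‖k u‖ ≤ ‖S u‖ := by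
      refine abs_le_of_sq_le_sq' ?_ (norm_nonneg _) |>.2
      rw [mul_pow, sq_abs]
      nlinarith [hSn u, sq_nonneg ‖A u‖]
    have h4 : ‖k u‖ ≤ |s|⁻¹ * ‖S u‖ := by
      rw [inv_mul_eq_div, le_div_iff₀ hs']
      linarith
    have h5 : ‖(k.prod A) u‖ ≤ (1 + |s|⁻¹) * ‖S u‖ := by
      have h6 : 0 ≤ |s|⁻¹ * ‖S u‖ := by positivity
      have h7 := norm_nonneg (S u)
      refine max_le ?_ ?_
      · change ‖k u‖ ≤ _
        linarith
      · change ‖A u‖ ≤ _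
        linarith
    have h8 : (c : ℝ) * ‖(k.prod A) u‖ ≤ c * ((1 + |s|⁻¹) * ‖S u‖) :=
      mul_le_mul_of_nonneg_left h5 c.2
    push_cast
    rw [mul_assoc, Real.norm_eq_abs]
    exact h1.trans h8
  have hSc : IsClosed (Set.range S) := hS.isClosed_range S.uniformContinuous
  have hSd : LinearMap.range S.toLinearMap = ⊤ := by
    have : CompleteSpace (LinearMap.range S.toLinearMap) :=
      IsClosed.completeSpace_coe (s := (LinearMap.range S.toLinearMap : Set H)) (hs := hSc)
    rw [← Submodule.orthogonal_eq_bot_iff, eq_bot_iff]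
    intro y hy
    rw [Submodule.mem_orthogonal'] at hy
    have hy' : ∀ w, inner ℂ ((Complex.I * (s : ℂ)) • y) (k w) = inner ℂ y (A w) := by
      intro w
      have h := hy (S w) ⟨w, rfl⟩
      change inner ℂ y (A w + (Complex.I * (s : ℂ)) • k w) = 0 at h
      rw [inner_add_right, inner_smul_right] at h
      rw [inner_smul_left]
      simp only [map_mul, Complex.conj_I, Complex.conj_ofReal]
      linear_combination -h
    obtain ⟨w, hw1, hw2⟩ := (graph_of_selfadjoint hA y _).2 hy'
    have h0 := hzero (-s) (neg_ne_zero.2 hs) w (by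
      rw [hw1, hw2, ← add_smul]
      simp)
    rw [Submodule.mem_bot, ← hw1, h0, map_zero]
  exact ⟨ContinuousLinearEquiv.ofBijective S
    (LinearMap.ker_eq_bot.2 hS.injective) hSd, by ext; rfl⟩

theorem index_eq_zero_of_selfadjoint {k : W →L[ℂ] H} {hk : Function.Injective k} {A : W →L[ℂ] H}
    (hA : IsSelfAdjoint (toUnbounded k hk A)) (hF : A.IsFredholm) :
    A.toLinearMap.index = 0 := by
  have hcl : IsClosed (LinearMap.range A.toLinearMap : Set H) := hF.isClosed_range
  have : CompleteSpace (LinearMap.range A.toLinearMap) :=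
    IsClosed.completeSpace_coe (s := (LinearMap.range A.toLinearMap : Set H)) (hs := hcl)
  have h1 : (LinearMap.range A.toLinearMap)ᗮ =
      (LinearMap.ker A.toLinearMap).map k.toLinearMap := by
    ext y
    rw [Submodule.mem_orthogonal', Submodule.mem_map]
    have h2 := graph_of_selfadjoint hA y 0
    constructor
    · intro h
      obtain ⟨w, hw1, hw2⟩ := h2.2 (fun w => by
        rw [inner_zero_left, h (A w) ⟨w, rfl⟩])
      exact ⟨w, hw2, hw1⟩
    · rintro ⟨w, hw1, hw2⟩ _ ⟨u, rfl⟩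
      have h3 := h2.1 ⟨w, hw2, hw1⟩ u
      rw [inner_zero_left] at h3
      exact h3.symm
  rw [LinearMap.index_eq_finrank_sub, sub_eq_zero, Nat.cast_inj,
    (Submodule.quotientEquivOfIsCompl _ _
      (Submodule.isCompl_orthogonal (LinearMap.range A.toLinearMap))).finrank_eq, h1]
  exact (Submodule.equivMapOfInjective k.toLinearMap hk _).finrank_eq

variable [CompleteSpace W]

/-- The suspension of a selfadjoint Fredholm family over a compact space is a Fredholm morphism
over `X × ℝ`. -/
theorem suspension_isFredholmMorphism [CompactSpace X] {k : W →L[ℂ] H} {Y : Set X}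
    {D : X → W →L[ℂ] H} (hD : IsSelfadjointFredholmFamily k Y D) :
    IsFredholmMorphism (Y ×ˢ Set.univ) (suspension k D) := by
  have h0 : ∀ x, suspension k D (x, 0) = D x := fun x => by simp [suspension]
  have hs : ∀ x (s : ℝ), s ≠ 0 → (suspension k D (x, s)).IsInvertible := fun x s h =>
    invertible_of_selfadjoint (hD.selfadjoint x) h
  refine ⟨?_, ?_, ?_, ?_, ?_⟩
  · unfold suspension
    have := hD.continuous
    fun_prop
  · rintro ⟨x, s⟩
    rcases eq_or_ne s 0 with rfl | h
    · rw [h0]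
      exact hD.fredholm x
    · obtain ⟨e, he⟩ := hs x s h
      rw [← he]
      exact ContinuousLinearMap.IsFredholm.of_isQuasiInverse
        (v := (e.symm : H →L[ℂ] W)) e.toLinearEquiv.isQuasiInverse
  · rintro ⟨x, s⟩
    rcases eq_or_ne s 0 with rfl | h
    · rw [h0]
      exact index_eq_zero_of_selfadjoint (hD.selfadjoint x) (hD.fredholm x)
    · obtain ⟨e, he⟩ := hs x s h
      rw [← he]
      exact LinearEquiv.index_eq_zero (e := e.toLinearEquiv)
  · refine ⟨Set.univ ×ˢ {0}, isCompact_univ.prod isCompact_singleton, ?_⟩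
    rintro ⟨x, s⟩ hx
    exact hs x s (by simpa using hx)
  · rintro ⟨x, s⟩ ⟨hx, -⟩
    rcases eq_or_ne s 0 with rfl | h
    · rw [h0]
      exact hD.invertible_on x hx
    · exact hs x s h

/-- The index bundle of a selfadjoint Fredholm family, `ind(D) ∈ K⁻¹(X, Y)`, defined as the index
bundle of its suspension. -/
noncomputable def sind [CompactSpace X] {k : W →L[ℂ] H} {Y : Set X} {D : X → W →L[ℂ] H}
    (hD : IsSelfadjointFredholmFamily k Y D) : KOdd.{u} X Y :=
  ind (suspension_isFredholmMorphism hD)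

end Selfadjoint

/-! ### The Riesz map -/

section Riesz

variable {E H : Type u} [NormedAddCommGroup E] [InnerProductSpace ℂ E] [CompleteSpace E]
  [NormedAddCommGroup H] [InnerProductSpace ℂ H] [CompleteSpace H]

/-- The operator `H → E` representing the scalar product of `H` in `E`, for `j : E → H`. -/
noncomputable def rieszMap (j : E →L[ℂ] H) : H →L[ℂ] E := ContinuousLinearMap.adjoint j

theorem inner_rieszMap (j : E →L[ℂ] H) (u : H) (v : E) :
    inner ℂ (rieszMap j u) v = inner ℂ u (j v) :=
  ContinuousLinearMap.adjoint_inner_left j v u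

end Riesz

end IndexBundle

/-! Write `K` for `rieszMap j`, the adjoint of `j`, and suppress the inclusions in formulas. Since
`B` and `D` come from the same form on the dense subspace `W`, one has `B = K D` on `W`, hence `(B +
isK₀) i = K (D + is)` with `K₀ = K j` (`apply_eq_rieszMap`). So the injective pair `(i, K)`
intertwines the suspension of `D` with the family `B + isK₀`.

If `V ⊂ H` is transversal to `D + is`, then `K V` is transversal to `B + isK₀`: at `s = 0` the sum
of the closed range of `B` and `K V` contains the dense range of `K`
(`range_sup_map_rieszMap_eq_top`), and for `s ≠ 0` the operator is invertible. The map `i` embeds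
the fibre over `V` into the fibre over `K V`. Both families have index zero, so both fibres have the
dimension of `V`, and the embedding is an isomorphism (`indexClass_eq_of_intertwining`).

It remains to replace `K₀` by the identity, along `B + is((1 - t)K₀ + t)`. For `s ≠ 0` these
operators are injective, because the imaginary part of their quadratic form is `s((1 - t)‖ju‖² +
t‖u‖²)`. They are compact perturbations of invertible operators, because `j` is compact, so the
Fredholm alternative makes them invertible (`suspensionHomotopy_isInvertible`). At `s = 0` the
family is `B` for all `t`. The non-invertible points thus stay in a compact set away from `Y`, and
homotopy invariance of the index class (`indexClass_eq_of_homotopy`) concludes. The latter also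
gives independence of the transversal subspace. -/

namespace IndexBundle

/-! ### Isomorphisms of bundles and of triples -/

section Isomorphisms

variable {Z : Type v} [TopologicalSpace Z]

/-- A morphism of vector bundles which is bijective on the fibres is an isomorphism. -/
noncomputable def CBundle.Hom.isoOfBijective {E E' : CBundle.{u} Z} (a : E.Hom E')
    (ha : ∀ z, Function.Bijective (a.map z)) : E.Iso E' where
  equiv z := LinearEquiv.ofBijective (a.map z) (ha z)
  continuous_equiv := a.continuous_map
  continuous_symm := by
    rw [continuous_iff_continuousAt]
    intro p₀
    obtain ⟨n, U, φ, ψ, hU, hz, hl, hr, hφ, hψ⟩ := E.exists_local p₀.proj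
    obtain ⟨n', U', φ', ψ', hU', hz', hl', hr', hφ', hψ'⟩ := E'.exists_local p₀.proj
    -- `exists_local` provides `ψ` only as a map; it is linear on `U` as the inverse of the linear
    -- `φ`. This turns `a` into a matrix valued function `g` in local coordinates.
    have hψlin : ∀ z (h : z ∈ U), ∃ l : (Fin n → ℂ) →ₗ[ℂ] E.Fiber z, ∀ f, l f = ψ z f := by
      intro z h
      let e : E.Fiber z ≃ₗ[ℂ] (Fin n → ℂ) := LinearEquiv.ofBijective (φ z)
        ⟨Function.LeftInverse.injective (hl z h), Function.RightInverse.surjective (hr z h)⟩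
      refine ⟨e.symm.toLinearMap, fun f => ?_⟩
      change e.symm f = _
      rw [LinearEquiv.symm_apply_eq]
      exact (hr z h f).symm
    choose l hlψ using hψlin
    classical
    let g : Z → (Fin n → ℂ) →L[ℂ] (Fin n' → ℂ) := fun z =>
      if h : z ∈ U then LinearMap.toContinuousLinearMap ((φ' z).comp ((a.map z).comp (l z h)))
      else 0
    have hg : ∀ z ∈ U, ∀ f, g z f = φ' z (a.map z (ψ z f)) := by
      intro z h f
      simp [g, h, hlψ]
    -- The model fibre is finite dimensional, so norm continuity may be checked on each fixed
    -- vector.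
    have hgc : ContinuousOn g (U ∩ U') := by
      rw [continuousOn_clm_apply]
      intro f
      have h1 : ContinuousOn (fun z => (⟨z, ψ z f⟩ : E.Total)) (U ∩ U') :=
        hψ.comp (f := fun z : Z => (z, f)) (by fun_prop) (fun z h => ⟨h.1, trivial⟩)
      have h2 := a.continuous_map.comp_continuousOn h1
      exact (hφ'.comp h2 (fun z h => h.2)).congr fun z h => hg z h.1 f
    have hginv : ∀ z ∈ U ∩ U', (g z).IsInvertible := by
      rintro z ⟨h, h'⟩
      have hb : Function.Bijective (g z) := by
        have : (g z : (Fin n → ℂ) → (Fin n' → ℂ)) = φ' z ∘ a.map z ∘ ψ z := funext (hg z h)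
        rw [this]
        exact Function.Bijective.comp
          ⟨Function.LeftInverse.injective (hl' z h'), Function.RightInverse.surjective (hr' z h')⟩
          ((ha z).comp
          ⟨Function.LeftInverse.injective (hr z h), Function.RightInverse.surjective (hl z h)⟩)
      exact ⟨ContinuousLinearEquiv.ofBijective _ (LinearMap.ker_eq_bot.2 hb.1)
        (LinearMap.range_eq_top.2 hb.2), by ext; rfl⟩
    have hgi : ContinuousOn (fun z => (g z).inverse) (U ∩ U') := fun z h =>
      ((hginv z h).contDiffAt_map_inverse (n := 0)).continuousAt.comp_continuousWithinAt (hgc z h)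
    have hUU : IsOpen (TotalSpace.proj ⁻¹' (U ∩ U') : Set E'.Total) :=
      (hU.inter hU').preimage E'.continuous_proj
    -- The inverse morphism is `ψ ∘ g⁻¹ ∘ φ'` in coordinates, and inversion of matrices is
    -- continuous.
    have hmain : ContinuousOn (fun p : E'.Total =>
        (⟨p.proj, ψ p.proj ((g p.proj).inverse (φ' p.proj p.2))⟩ : E.Total))
        (TotalSpace.proj ⁻¹' (U ∩ U')) := by
      refine hψ.comp (f := fun p : E'.Total => (p.proj, (g p.proj).inverse (φ' p.proj p.2)))
        (E'.continuous_proj.continuousOn.prodMk ?_) (fun p h => ⟨h.1, trivial⟩)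
      exact (hgi.comp E'.continuous_proj.continuousOn fun p h => h).clm_apply
        (hφ'.mono fun p h => h.2)
    refine (hmain.congr ?_).continuousAt (hUU.mem_nhds ⟨hz, hz'⟩)
    rintro ⟨z, u⟩ ⟨h, h'⟩
    refine congrArg (TotalSpace.mk z) ((LinearEquiv.symm_apply_eq _).2 ?_)
    change u = a.map z _
    have h1 := (hginv z ⟨h, h'⟩).self_apply_inverse (φ' z u)
    rw [hg z h] at h1
    have h2 := congrArg (ψ' z) h1
    rw [hl' z h', hl' z h'] at h2
    exact h2.symm

theorem Triple.isomorphic_of_bijective {ξ η : Triple.{u} Z} (φ₀ : ξ.E₀.Hom η.E₀)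
    (φ₁ : ξ.E₁.Hom η.E₁) (h₀ : ∀ z, Function.Bijective (φ₀.map z))
    (h₁ : ∀ z, Function.Bijective (φ₁.map z))
    (h : ∀ z u, η.a.map z (φ₀.map z u) = φ₁.map z (ξ.a.map z u)) : ξ.Isomorphic η :=
  ⟨φ₀.isoOfBijective h₀, φ₁.isoOfBijective h₁, h⟩

/-- The trivial triple given by the identity of a product bundle. -/
def Triple.product (Z : Type v) [TopologicalSpace Z] (V : Type u) [NormedAddCommGroup V]
    [NormedSpace ℂ V] [FiniteDimensional ℂ V] : Triple.{u} Z :=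
  ⟨CBundle.product Z V, CBundle.product Z V, ⟨fun _ => LinearMap.id, continuous_id⟩⟩

theorem Triple.product_isTrivial (V : Type u) [NormedAddCommGroup V]
    [NormedSpace ℂ V] [FiniteDimensional ℂ V] : (Triple.product Z V).IsTrivial :=
  Set.eq_empty_of_forall_notMem fun _ h => h Function.bijective_id

/-- Isomorphic triples define the same class. -/
theorem K.mk_eq_of_isomorphic {Y : Set Z} {ξ η : L.{u} Z Y} (h : ξ.1.Isomorphic η.1) :
    K.mk ξ = K.mk η := by
  let q : C(Z × unitInterval, Z) := ⟨Prod.fst, continuous_fst⟩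
  let O : Triple.{u} Z := Triple.product Z PUnit.{u + 1}
  obtain ⟨φ₀, φ₁, hφ⟩ := h
  have hfst : ∀ E E' : CBundle.{u} Z, Continuous fun p : (E.directSum E').Total =>
      ((⟨p.proj, p.2.1⟩, ⟨p.proj, p.2.2⟩) : E.Total × E'.Total) :=
    fun E E' => continuous_induced_dom
  have hpb : ∀ t (E : CBundle.{u} Z),
      Continuous (fun p : ((E.pullback q).pullback
        (Triple.slice Z t)).Total => (⟨p.proj, p.2⟩ : E.Total)) := by
    intro t E
    have h1 : Continuous (fun p : (E.pullback q).Total =>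
        ((p.proj, ⟨p.proj.1, p.2⟩) : (Z × unitInterval) × E.Total)) := continuous_induced_dom
    have h2 : Continuous (fun p : ((E.pullback q).pullback (Triple.slice Z t)).Total =>
        ((p.proj, ⟨(p.proj, t), p.2⟩) : Z × (E.pullback q).Total)) := continuous_induced_dom
    exact continuous_snd.comp (h1.comp (continuous_snd.comp h2))
  -- The homotopy is constant, a pullback along the projection of the cylinder; the given
  -- isomorphism is used only to identify its end at `1`. The zero triple `O` fills the stabilising
  -- summands.
  refine Quot.sound ⟨O, O, Triple.product_isTrivial _, Triple.product_isTrivial _,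
    (ξ.1.directSum O).pullback q, ?_, ?_, ?_⟩
  · have hs : ((ξ.1.directSum O).pullback q).supp = ξ.1.supp ×ˢ Set.univ := by
      ext ⟨z, t⟩
      change ¬ Function.Bijective (Prod.map (ξ.1.a.map z) (O.a.map z)) ↔ _
      have : Function.Bijective (O.a.map z) := Function.bijective_id
      rw [Prod.map_bijective]
      simp [this, Triple.supp]
    rw [Triple.IsAdmissible, hs]
    exact ⟨ξ.2.1.prod isCompact_univ, fun p hp h => ξ.2.2 hp.1 h.1⟩
  · exact Triple.isomorphic_of_bijective ⟨fun z => LinearMap.id, hpb 0 _⟩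
      ⟨fun z => LinearMap.id, hpb 0 _⟩ (fun z => Function.bijective_id)
      (fun z => Function.bijective_id) fun z u => rfl
  · refine Triple.isomorphic_of_bijective
      ⟨fun z => (φ₀.equiv z).toLinearMap.prodMap LinearMap.id, ?_⟩
      ⟨fun z => (φ₁.equiv z).toLinearMap.prodMap LinearMap.id, ?_⟩
      (fun z => (φ₀.equiv z).bijective.prodMap Function.bijective_id)
      (fun z => (φ₁.equiv z).bijective.prodMap Function.bijective_id) ?_
    · have h := (hfst ξ.1.E₀ O.E₀).comp (hpb 1 (ξ.1.directSum O).E₀)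
      exact continuous_induced_rng.2 ((φ₀.continuous_equiv.comp (continuous_fst.comp h)).prodMk
        (continuous_snd.comp h))
    · have h := (hfst ξ.1.E₁ O.E₁).comp (hpb 1 (ξ.1.directSum O).E₁)
      exact continuous_induced_rng.2 ((φ₁.continuous_equiv.comp (continuous_fst.comp h)).prodMk
        (continuous_snd.comp h))
    · rintro z ⟨u, w⟩
      exact Prod.ext (hφ z u) rfl

end Isomorphisms

/-! ### Stabilised operators and homotopy invariance of the index class -/

section ExtendedOperator

variable {Z : Type v} [TopologicalSpace Z]
variable {W F M : Type u} [NormedAddCommGroup W] [NormedSpace ℂ W]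
  [NormedAddCommGroup F] [NormedSpace ℂ F] [NormedAddCommGroup M] [NormedSpace ℂ M]

/-- The operator `(w, m) ↦ (S w - φ m, m)`. -/
noncomputable def extOp (S : W →L[ℂ] F) (φ : M →L[ℂ] F) : W × M →L[ℂ] F × M :=
  ((S.comp (ContinuousLinearMap.fst ℂ W M)) - φ.comp (ContinuousLinearMap.snd ℂ W M)).prod
    (ContinuousLinearMap.snd ℂ W M)

@[simp] theorem extOp_apply (S : W →L[ℂ] F) (φ : M →L[ℂ] F) (p : W × M) :
    extOp S φ p = (S p.1 - φ p.2, p.2) := rfl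

theorem continuous_extOp {T : Z → W →L[ℂ] F} {φ : Z → M →L[ℂ] F} (hT : Continuous T)
    (hφ : Continuous φ) : Continuous fun z => extOp (T z) (φ z) :=
  (ContinuousLinearMap.prodₗᵢ ℂ).continuous.comp
    (((hT.clm_comp continuous_const).sub (hφ.clm_comp continuous_const)).prodMk continuous_const)

/-- The operator is block triangular, with inverse `(f, m) ↦ (S⁻¹(f + φ m), m)`. -/
theorem extOp_isInvertible {S : W →L[ℂ] F} (hS : S.IsInvertible) (φ : M →L[ℂ] F) :
    (extOp S φ).IsInvertible := by
  obtain ⟨e, rfl⟩ := hS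
  refine ContinuousLinearMap.IsInvertible.of_inverse (g := ((e.symm : F →L[ℂ] W).comp
    (ContinuousLinearMap.fst ℂ F M + φ.comp (ContinuousLinearMap.snd ℂ F M))).prod
    (ContinuousLinearMap.snd ℂ F M)) ?_ ?_
  · ext x <;> simp
  · ext x <;> simp

/-- A quasi-inverse of `S`, extended by the identity of `M`, is one here: the defects change only by
terms that factor through `φ`, which has finite rank. -/
theorem extOp_isFredholm [FiniteDimensional ℂ M] {S : W →L[ℂ] F} (hS : S.IsFredholm)
    (φ : M →L[ℂ] F) : (extOp S φ).IsFredholm := by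
  obtain ⟨v, hl, hr⟩ := hS.exists_isQuasiInverse
  have hl' := LinearMap.FiniteRangeSetoid.equiv_iff_hasNoetherianRange.1 hl
  have hr' := LinearMap.FiniteRangeSetoid.equiv_iff_hasNoetherianRange.1 hr
  refine ContinuousLinearMap.IsFredholm.of_isQuasiInverse
    (v := (v.comp (ContinuousLinearMap.fst ℂ F M)).prod (ContinuousLinearMap.snd ℂ F M)) ⟨?_, ?_⟩
  · refine LinearMap.FiniteRangeSetoid.equiv_iff_hasNoetherianRange.2 ?_
    have h1 : (LinearMap.inl ℂ W M ∘ₗ (v.toLinearMap ∘ₗ S.toLinearMap - LinearMap.id) ∘ₗ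
        LinearMap.fst ℂ W M).HasNoetherianRange :=
      (hl'.comp_right (LinearMap.fst ℂ W M)).comp_left _
    have h2 : (LinearMap.inl ℂ W M ∘ₗ v.toLinearMap ∘ₗ φ.toLinearMap ∘ₗ
        LinearMap.snd ℂ W M).HasNoetherianRange :=
      (((LinearMap.HasNoetherianRange.of_isNoetherian_dom (f := φ.toLinearMap)).comp_right
        (LinearMap.snd ℂ W M)).comp_left v.toLinearMap).comp_left _
    have h3 : ((v.comp (ContinuousLinearMap.fst ℂ F M)).prod
        (ContinuousLinearMap.snd ℂ F M)).toLinearMap ∘ₗ (extOp S φ).toLinearMap - LinearMap.id =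
        LinearMap.inl ℂ W M ∘ₗ (v.toLinearMap ∘ₗ S.toLinearMap - LinearMap.id) ∘ₗ
          LinearMap.fst ℂ W M -
        LinearMap.inl ℂ W M ∘ₗ v.toLinearMap ∘ₗ φ.toLinearMap ∘ₗ LinearMap.snd ℂ W M := by
      ext x <;> simp
    exact h3 ▸ h1.sub h2
  · refine LinearMap.FiniteRangeSetoid.equiv_iff_hasNoetherianRange.2 ?_
    have h1 : (LinearMap.inl ℂ F M ∘ₗ (S.toLinearMap ∘ₗ v.toLinearMap - LinearMap.id) ∘ₗ
        LinearMap.fst ℂ F M).HasNoetherianRange :=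
      (hr'.comp_right (LinearMap.fst ℂ F M)).comp_left _
    have h2 : (LinearMap.inl ℂ F M ∘ₗ φ.toLinearMap ∘ₗ
        LinearMap.snd ℂ F M).HasNoetherianRange :=
      ((LinearMap.HasNoetherianRange.of_isNoetherian_dom (f := φ.toLinearMap)).comp_right
        (LinearMap.snd ℂ F M)).comp_left _
    have h3 : (extOp S φ).toLinearMap ∘ₗ ((v.comp (ContinuousLinearMap.fst ℂ F M)).prod
        (ContinuousLinearMap.snd ℂ F M)).toLinearMap - LinearMap.id =
        LinearMap.inl ℂ F M ∘ₗ (S.toLinearMap ∘ₗ v.toLinearMap - LinearMap.id) ∘ₗ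
          LinearMap.fst ℂ F M -
        LinearMap.inl ℂ F M ∘ₗ φ.toLinearMap ∘ₗ LinearMap.snd ℂ F M := by
      ext x <;> simp
    exact h3 ▸ h1.sub h2

/-- The kernel is `ker S × 0`, and `(f, m) ↦ f + φ m` identifies the cokernel with that of `S`. -/
theorem index_extOp [FiniteDimensional ℂ M] (S : W →L[ℂ] F)
    (φ : M →L[ℂ] F) : (extOp S φ).toLinearMap.index = S.toLinearMap.index := by
  have h1 : Module.finrank ℂ (LinearMap.ker (extOp S φ).toLinearMap) =
      Module.finrank ℂ (LinearMap.ker S.toLinearMap) := by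
    have : LinearMap.ker (extOp S φ).toLinearMap =
        (LinearMap.ker S.toLinearMap).map (LinearMap.inl ℂ W M) := by
      ext ⟨w, m⟩
      simp only [LinearMap.mem_ker, ContinuousLinearMap.coe_coe, extOp_apply, Prod.mk_eq_zero,
        Submodule.mem_map, LinearMap.inl_apply, Prod.mk.injEq]
      constructor
      · rintro ⟨h, rfl⟩
        exact ⟨w, by simpa using h, rfl, rfl⟩
      · rintro ⟨w, h, rfl, rfl⟩
        simpa using h
    rw [this]
    exact (Submodule.equivMapOfInjective _ LinearMap.inl_injective _).finrank_eq.symm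
  have h2 : Module.finrank ℂ ((F × M) ⧸ LinearMap.range (extOp S φ).toLinearMap) =
      Module.finrank ℂ (F ⧸ LinearMap.range S.toLinearMap) := by
    let g : F × M →ₗ[ℂ] F ⧸ LinearMap.range S.toLinearMap :=
      (LinearMap.range S.toLinearMap).mkQ ∘ₗ LinearMap.coprod LinearMap.id φ.toLinearMap
    have hg : LinearMap.ker g = LinearMap.range (extOp S φ).toLinearMap := by
      ext ⟨f, m⟩
      simp only [g, LinearMap.mem_ker, LinearMap.comp_apply, Submodule.mkQ_apply,
        Submodule.Quotient.mk_eq_zero, LinearMap.mem_range, LinearMap.coprod_apply,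
        LinearMap.id_apply, ContinuousLinearMap.coe_coe, extOp_apply, Prod.mk.injEq, Prod.exists]
      constructor
      · rintro ⟨w, h⟩
        exact ⟨w, m, by simp [h], rfl⟩
      · rintro ⟨w, m, h, rfl⟩
        exact ⟨w, by simp [← h]⟩
    have hs : Function.Surjective g := by
      refine (Submodule.mkQ_surjective _).comp fun f => ⟨(f, 0), by simp⟩
    rw [← hg]
    exact (g.quotKerEquivOfSurjective hs).finrank_eq
  rw [LinearMap.index_eq_finrank_sub, LinearMap.index_eq_finrank_sub, h1, h2]

theorem extOp_isFredholmMorphism [FiniteDimensional ℂ M] {Y : Set Z} {T : Z → W →L[ℂ] F}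
    (hT : IsFredholmMorphism Y T) {φ : Z → M →L[ℂ] F} (hφ : Continuous φ) :
    IsFredholmMorphism Y fun z => extOp (T z) (φ z) where
  continuous := continuous_extOp hT.continuous hφ
  fredholm z := extOp_isFredholm (hT.fredholm z) _
  index_zero z := (index_extOp _ _).trans (hT.index_zero z)
  invertible_off_compact := by
    obtain ⟨C, hC, h⟩ := hT.invertible_off_compact
    exact ⟨C, hC, fun z hz => extOp_isInvertible (h z hz) _⟩
  invertible_on z hz := extOp_isInvertible (hT.invertible_on z hz) _

/-- This is the purpose of `extOp`: a moving subspace, the range of `φ z`, is traded for the fixed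
subspace `0 × M`, whose preimage consists of the pairs with `T w = φ m`. -/
theorem isTransversal_extOp {Z : Type*} {T : Z → W →L[ℂ] F} {φ : Z → M →L[ℂ] F}
    (h : ∀ z, LinearMap.range (T z).toLinearMap ⊔ LinearMap.range (φ z).toLinearMap = ⊤) :
    IsTransversal (fun z => extOp (T z) (φ z)) (LinearMap.range (LinearMap.inr ℂ F M)) := by
  intro z
  rw [eq_top_iff]
  rintro ⟨f, m⟩ _
  have hf : f ∈ LinearMap.range (T z).toLinearMap ⊔ LinearMap.range (φ z).toLinearMap :=
    h z ▸ Submodule.mem_top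
  obtain ⟨_, ⟨w, rfl⟩, _, ⟨n, rfl⟩, rfl⟩ := Submodule.mem_sup.1 hf
  exact Submodule.mem_sup.2 ⟨extOp (T z) (φ z) (w, -n), ⟨_, rfl⟩, (0, m + n), ⟨m + n, rfl⟩,
    by simp⟩

variable [CompleteSpace W] [CompleteSpace F] [FiniteDimensional ℂ M]

/-- If `φ` is the projection onto a direct summand `V` of `M`, the index triple of `extOp T φ` is
the direct sum of the one of `T` and a trivial triple. -/
theorem indexTriple_extOp_isomorphic {Z' : Type v} [TopologicalSpace Z'] {Y : Set Z} {Y' : Set Z'}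
    {A : Z' → W × M →L[ℂ] F × M} (hA : IsFredholmMorphism Y' A)
    (hV' : IsTransversal A (LinearMap.range (LinearMap.inr ℂ F M)))
    {T : Z → W →L[ℂ] F} (hT : IsFredholmMorphism Y T)
    (V : Submodule ℂ F) [FiniteDimensional ℂ V] (hV : IsTransversal T V)
    {N : Type u} [NormedAddCommGroup N] [NormedSpace ℂ N] [FiniteDimensional ℂ N]
    (e : M ≃L[ℂ] V × N) (φ : M →L[ℂ] F) (hφ : ∀ m, φ m = (e m).1)
    (f : C(Z, Z')) (hf : ∀ z, A (f z) = extOp (T z) φ) :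
    ((indexTriple hA _ hV').pullback f).Isomorphic
      ((indexTriple hT V hV).directSum (Triple.product Z N)) := by
  have key : ∀ z (x : W × M), A (f z) x ∈ LinearMap.range (LinearMap.inr ℂ F M) ↔
      T z x.1 = (e x.2).1 := by
    rintro z ⟨w, m⟩
    rw [hf z]
    simp [← hφ, sub_eq_zero, eq_comm (a := (0 : F))]
  -- By `key` the `V`-component of `m` is forced to be `T w`, so a point of the fibre is given by
  -- `w` and the free `N`-component.
  let α : ∀ z, (LinearMap.range (LinearMap.inr ℂ F M)).comap (A (f z)).toLinearMap →ₗ[ℂ]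
      V.comap (T z).toLinearMap × N := fun z =>
    { toFun := fun x => (⟨x.1.1, by
        rw [Submodule.mem_comap, ContinuousLinearMap.coe_coe, (key z x.1).1 x.2]
        exact (e x.1.2).1.2⟩, (e x.1.2).2)
      map_add' := fun x y => by ext <;> simp
      map_smul' := fun c x => by ext <;> simp }
  let β : LinearMap.range (LinearMap.inr ℂ F M) →ₗ[ℂ] V × N :=
    e.toLinearMap ∘ₗ LinearMap.snd ℂ F M ∘ₗ Submodule.subtype _
  have hβ : Function.Bijective β := by
    constructor
    · rintro ⟨_, m, rfl⟩ ⟨_, m', rfl⟩ h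
      have : m = m' := e.injective h
      rw [this]
    · intro p
      exact ⟨⟨(0, e.symm p), e.symm p, rfl⟩, e.apply_symm_apply p⟩
  refine Triple.isomorphic_of_bijective ⟨α, ?_⟩ ⟨fun z => β, ?_⟩ ?_ (fun z => hβ) ?_
  · have h1 : Continuous fun p : ((indexTriple hA _ hV').E₀.pullback f).Total =>
        ((p.proj, ⟨f p.proj, p.2⟩) : Z × (indexTriple hA _ hV').E₀.Total) :=
      continuous_induced_dom
    have h2 : Continuous fun p : (indexTriple hA _ hV').E₀.Total =>
        ((p.proj, p.2.1) : Z' × (W × M)) := continuous_induced_dom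
    have h3 := continuous_snd.comp (h2.comp (continuous_snd.comp h1))
    refine continuous_induced_rng.2 (Continuous.prodMk ?_ ?_)
    · exact continuous_induced_rng.2
        ((continuous_fst.comp h1).prodMk (continuous_fst.comp h3))
    · exact continuous_induced_rng.2 ((continuous_fst.comp h1).prodMk
        (continuous_snd.comp (e.continuous.comp (continuous_snd.comp h3))))
  · have h1 : Continuous fun p : ((indexTriple hA _ hV').E₁.pullback f).Total =>
        ((p.proj, ⟨f p.proj, p.2⟩) : Z × (indexTriple hA _ hV').E₁.Total) :=
      continuous_induced_dom
    have h2 : Continuous fun p : (indexTriple hA _ hV').E₁.Total =>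
        ((p.proj, p.2) : Z' × LinearMap.range (LinearMap.inr ℂ F M)) := continuous_induced_dom
    have h3 := e.continuous.comp (continuous_snd.comp (continuous_subtype_val.comp
      (continuous_snd.comp (h2.comp (continuous_snd.comp h1)))))
    refine continuous_induced_rng.2 (Continuous.prodMk ?_ ?_)
    · exact continuous_induced_rng.2
        ((continuous_fst.comp h1).prodMk (continuous_fst.comp h3))
    · exact continuous_induced_rng.2
        ((continuous_fst.comp h1).prodMk (continuous_snd.comp h3))
  · intro z
    constructor
    · rintro ⟨⟨w, m⟩, h⟩ ⟨⟨w', m'⟩, h'⟩ hh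
      have h1 : w = w' := congrArg (fun x => x.1.1) hh
      have h2 : (e m).2 = (e m').2 := congrArg (fun x => x.2) hh
      have h3 := (key z _).1 h
      have h4 := (key z _).1 h'
      subst h1
      have h5 : m = m' := e.injective (Prod.ext (Subtype.ext (h3.symm.trans h4)) h2)
      subst h5
      rfl
    · rintro ⟨⟨w, hw⟩, n⟩
      refine ⟨⟨(w, e.symm (⟨T z w, hw⟩, n)), (key z _).2 (by simp)⟩, ?_⟩
      have h1 : (e (e.symm (⟨T z w, hw⟩, n))).2 = n := by rw [e.apply_symm_apply]
      exact Prod.ext rfl h1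
  · rintro z ⟨x, hx⟩
    have h1 : (A (f z) x).2 = x.2 := by
      rw [hf z]
      rfl
    have h2 : T z x.1 ∈ V := (key z x).1 hx ▸ (e x.2).1.2
    change ((⟨T z x.1, h2⟩ : V), (e x.2).2) = e (A (f z) x).2
    rw [h1]
    exact Prod.ext (Subtype.ext ((key z x).1 hx)) rfl

/-- Homotopy invariance of the index class, and its independence of the transversal subspace. -/
theorem indexClass_eq_of_homotopy {Y : Set Z} {T : Z × unitInterval → W →L[ℂ] F}
    (hT : IsFredholmMorphism (Y ×ˢ Set.univ) T) (V V' : Submodule ℂ F) [FiniteDimensional ℂ V]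
    [FiniteDimensional ℂ V'] (hV : IsTransversal T V) (hV' : IsTransversal T V')
    {T₀ T₁ : Z → W →L[ℂ] F} (h₀ : IsFredholmMorphism Y T₀) (h₁ : IsFredholmMorphism Y T₁)
    (hT₀ : ∀ z, T (z, 0) = T₀ z) (hT₁ : ∀ z, T (z, 1) = T₁ z)
    (hV₀ : IsTransversal T₀ V) (hV₁ : IsTransversal T₁ V') :
    indexClass h₀ V hV₀ = indexClass h₁ V' hV₁ := by
  -- `(v, v') ↦ (1 - t) v + t v'` has range `V` at `t = 0` and `V'` at `t = 1`. Its range contains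
  -- `V'` whenever `t ≠ 0`, so transversality of both subspaces along the whole homotopy suffices.
  let φ : Z × unitInterval → V × V' →L[ℂ] F := fun p =>
    ((1 - (p.2 : ℝ) : ℝ) : ℂ) • V.subtypeL.comp (ContinuousLinearMap.fst ℂ V V') +
      ((p.2 : ℝ) : ℂ) • V'.subtypeL.comp (ContinuousLinearMap.snd ℂ V V')
  have hφ : Continuous φ := by fun_prop
  have htr : ∀ p, LinearMap.range (T p).toLinearMap ⊔ LinearMap.range (φ p).toLinearMap = ⊤ := by
    rintro p
    rcases eq_or_ne ((p.2 : ℝ) : ℂ) 0 with h | h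
    · refine top_le_iff.1 ((hV p).symm.le.trans (sup_le_sup_left (fun v hv => ?_) _))
      refine ⟨(⟨v, hv⟩, 0), ?_⟩
      have h' : (p.2 : ℝ) = 0 := by exact_mod_cast h
      simp [φ, h']
    · refine top_le_iff.1 ((hV' p).symm.le.trans (sup_le_sup_left (fun v hv => ?_) _))
      refine ⟨(0, (((p.2 : ℝ) : ℂ))⁻¹ • ⟨v, hv⟩), ?_⟩
      simpa [φ] using smul_inv_smul₀ h v
  have hA := extOp_isFredholmMorphism hT hφ
  have hAV := isTransversal_extOp htr
  -- At each end the unused factor of `V × V'` splits off as a trivial triple: `V'` at `0` and `V`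
  -- at `1`.
  refine Quot.sound ⟨Triple.product Z V', Triple.product Z V, Triple.product_isTrivial _,
    Triple.product_isTrivial _, indexTriple hA _ hAV, indexTriple_isAdmissible hA _ hAV, ?_, ?_⟩
  · refine indexTriple_extOp_isomorphic hA hAV h₀ V hV₀ (ContinuousLinearEquiv.refl ℂ _)
      (φ := V.subtypeL.comp (ContinuousLinearMap.fst ℂ V V')) (fun m => rfl)
      (Triple.slice Z 0) fun z => ?_
    change extOp (T (z, 0)) (φ (z, 0)) = _
    rw [hT₀]
    congr 1
    simp [φ]
  · refine indexTriple_extOp_isomorphic hA hAV h₁ V' hV₁ (ContinuousLinearEquiv.prodComm ℂ V V')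
      (φ := V'.subtypeL.comp (ContinuousLinearMap.snd ℂ V V')) (fun m => rfl)
      (Triple.slice Z 1) fun z => ?_
    change extOp (T (z, 1)) (φ (z, 1)) = _
    rw [hT₁]
    congr 1
    simp [φ]

end ExtendedOperator

/-! ### Families intertwined by injective operators -/

section Intertwining

variable {Z : Type v} [TopologicalSpace Z]
variable {W F W' F' : Type u} [NormedAddCommGroup W] [NormedSpace ℂ W]
  [NormedAddCommGroup F] [NormedSpace ℂ F] [NormedAddCommGroup W'] [NormedSpace ℂ W']
  [NormedAddCommGroup F'] [NormedSpace ℂ F']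

/-- The restriction `T⁻¹(V) → V` has the kernel of `T` and, by transversality, the cokernel of `T`.
Its index is therefore zero, and between finite dimensional spaces the index is the difference of
the dimensions. -/
theorem finrank_comap_of_index_eq_zero {T : W →L[ℂ] F} (hT : T.IsFredholm)
    (h0 : T.toLinearMap.index = 0) (V : Submodule ℂ F) [FiniteDimensional ℂ V]
    (hV : LinearMap.range T.toLinearMap ⊔ V = ⊤) :
    Module.finrank ℂ (V.comap T.toLinearMap) = Module.finrank ℂ V := by
  have := finiteDimensional_comap hT V
  let R : V.comap T.toLinearMap →ₗ[ℂ] V := T.toLinearMap.restrict fun _ hu => hu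
  have h1 : Module.finrank ℂ (LinearMap.ker R) =
      Module.finrank ℂ (LinearMap.ker T.toLinearMap) := by
    have h : (LinearMap.ker R).map (Submodule.subtype _) = LinearMap.ker T.toLinearMap := by
      ext u
      simp only [Submodule.mem_map, LinearMap.mem_ker, Submodule.subtype_apply]
      constructor
      · rintro ⟨x, hx, rfl⟩
        exact congrArg Subtype.val hx
      · intro hu
        exact ⟨⟨u, by simp [hu]⟩, Subtype.ext hu, rfl⟩
    rw [← h]
    exact (Submodule.equivMapOfInjective _ (Submodule.injective_subtype _) _).finrank_eq
  have h2 : Module.finrank ℂ (V ⧸ LinearMap.range R) =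
      Module.finrank ℂ (F ⧸ LinearMap.range T.toLinearMap) := by
    let g : V →ₗ[ℂ] F ⧸ LinearMap.range T.toLinearMap :=
      (LinearMap.range T.toLinearMap).mkQ ∘ₗ V.subtype
    have hg : LinearMap.ker g = LinearMap.range R := by
      ext ⟨v, hv⟩
      simp only [g, LinearMap.mem_ker, LinearMap.comp_apply, Submodule.mkQ_apply,
        Submodule.Quotient.mk_eq_zero, Submodule.subtype_apply]
      constructor
      · rintro ⟨w, rfl⟩
        exact ⟨⟨w, hv⟩, rfl⟩
      · rintro ⟨w, h⟩
        exact ⟨w, congrArg Subtype.val h⟩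
    have hs : Function.Surjective g := by
      intro x
      obtain ⟨f, rfl⟩ := Submodule.mkQ_surjective _ x
      obtain ⟨r, hr, v, hv, rfl⟩ := Submodule.mem_sup.1 (hV ▸ Submodule.mem_top :
        f ∈ LinearMap.range T.toLinearMap ⊔ V)
      refine ⟨⟨v, hv⟩, ?_⟩
      simp only [g, LinearMap.comp_apply, Submodule.subtype_apply, map_add]
      rw [Submodule.mkQ_apply _ r, (Submodule.Quotient.mk_eq_zero _).2 hr, zero_add]
    rw [← hg]
    exact (g.quotKerEquivOfSurjective hs).finrank_eq
  have h3 := LinearMap.index_eq_of_finiteDimensional (f := R)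
  rw [LinearMap.index_eq_finrank_sub, h1, h2, ← LinearMap.index_eq_finrank_sub, h0] at h3
  omega

variable [CompleteSpace W] [CompleteSpace F] [CompleteSpace W'] [CompleteSpace F']

/-- The index classes of two families intertwined by injective operators agree. -/
theorem indexClass_eq_of_intertwining {Y : Set Z} {T : Z → W →L[ℂ] F} {T' : Z → W' →L[ℂ] F'}
    (hT : IsFredholmMorphism Y T) (hT' : IsFredholmMorphism Y T')
    (a : W →L[ℂ] W') (b : F →L[ℂ] F') (ha : Function.Injective a) (hb : Function.Injective b)
    (hab : ∀ z w, T' z (a w) = b (T z w)) (V : Submodule ℂ F) [FiniteDimensional ℂ V]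
    (hV : IsTransversal T V) (hV' : IsTransversal T' (V.map b.toLinearMap)) :
    indexClass hT V hV = indexClass hT' (V.map b.toLinearMap) hV' := by
  apply K.mk_eq_of_isomorphic
  let β : V →ₗ[ℂ] V.map b.toLinearMap := b.toLinearMap.restrict fun v hv => ⟨v, hv, rfl⟩
  let α : ∀ z, V.comap (T z).toLinearMap →ₗ[ℂ]
      (V.map b.toLinearMap).comap (T' z).toLinearMap := fun z =>
    a.toLinearMap.restrict fun w hw => ⟨T z w, hw, (hab z w).symm⟩
  have hβ : Function.Bijective β := by
    constructor
    · intro v v' h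
      exact Subtype.ext (hb (congrArg Subtype.val h))
    · rintro ⟨_, v, hv, rfl⟩
      exact ⟨⟨v, hv⟩, rfl⟩
  have hα : ∀ z, Function.Bijective (α z) := by
    intro z
    have hi : Function.Injective (α z) := fun v v' h =>
      Subtype.ext (ha (congrArg Subtype.val h))
    have := finiteDimensional_comap (hT.fredholm z) V
    have := finiteDimensional_comap (hT'.fredholm z) (V.map b.toLinearMap)
    -- Surjectivity comes from a dimension count: the fibres have the dimensions of `V` and of its
    -- image under `b`, and `b` is injective.
    refine ⟨hi, (LinearMap.injective_iff_surjective_of_finrank_eq_finrank ?_).1 hi⟩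
    rw [finrank_comap_of_index_eq_zero (hT.fredholm z) (hT.index_zero z) V (hV z),
      finrank_comap_of_index_eq_zero (hT'.fredholm z) (hT'.index_zero z) _ (hV' z)]
    exact (LinearEquiv.ofBijective β hβ).finrank_eq
  refine Triple.isomorphic_of_bijective ⟨α, ?_⟩ ⟨fun _ => β, ?_⟩ hα (fun _ => hβ) ?_
  · have h : Continuous fun p : (kernelBundle hT V hV).Total => ((p.proj, p.2.1) : Z × W) :=
      continuous_induced_dom
    exact continuous_induced_rng.2
      ((continuous_fst.comp h).prodMk (a.continuous.comp (continuous_snd.comp h)))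
  · have h : Continuous fun p : (CBundle.product Z V).Total => ((p.proj, p.2) : Z × V) :=
      continuous_induced_dom
    exact continuous_induced_rng.2 ((continuous_fst.comp h).prodMk
      (Continuous.subtype_mk (b.continuous.comp (continuous_subtype_val.comp
        (continuous_snd.comp h))) _))
  · rintro z ⟨w, hw⟩
    exact Subtype.ext (hab z w)

end Intertwining

/-! ### Bounded symmetric operators and compact perturbations -/

section BoundedSelfadjoint

variable {E : Type u} [NormedAddCommGroup E] [InnerProductSpace ℂ E]

theorem orthogonal_range_of_symmetric {B : E →L[ℂ] E}
    (hB : ∀ u v, inner ℂ (B u) v = inner ℂ u (B v)) :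
    (LinearMap.range B.toLinearMap)ᗮ = LinearMap.ker B.toLinearMap := by
  ext u
  rw [Submodule.mem_orthogonal', LinearMap.mem_ker, ContinuousLinearMap.coe_coe]
  constructor
  · intro h
    refine ext_inner_right ℂ fun v => ?_
    rw [hB, inner_zero_left]
    exact h _ ⟨v, rfl⟩
  · rintro h _ ⟨v, rfl⟩
    rw [ContinuousLinearMap.coe_coe, ← hB, h, inner_zero_left]

variable [CompleteSpace E]

theorem isInvertible_of_bijective {F G : Type*} [NormedAddCommGroup F] [NormedSpace ℂ F]
    [CompleteSpace F] [NormedAddCommGroup G] [NormedSpace ℂ G] [CompleteSpace G]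
    {A : F →L[ℂ] G} (h : Function.Bijective A) : A.IsInvertible :=
  ⟨ContinuousLinearEquiv.ofBijective A (LinearMap.ker_eq_bot.2 h.1)
    (LinearMap.range_eq_top.2 h.2), by ext; rfl⟩

/-- With the whole space as domain there is no domain question: symmetry forces `y = B x` for each
`(x, y)` in the graph of the adjoint. -/
theorem isSelfAdjoint_toUnbounded_id {B : E →L[ℂ] E}
    (hB : ∀ u v, inner ℂ (B u) v = inner ℂ u (B v))
    (hk : Function.Injective (ContinuousLinearMap.id ℂ E)) :
    IsSelfAdjoint (toUnbounded (ContinuousLinearMap.id ℂ E) hk B) := by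
  have hd : Dense ((toUnbounded (ContinuousLinearMap.id ℂ E) hk B).domain : Set E) := by
    have : ((toUnbounded (ContinuousLinearMap.id ℂ E) hk B).domain : Set E) = Set.univ :=
      Set.eq_univ_of_forall fun x => ⟨x, rfl⟩
    rw [this]
    exact dense_univ
  rw [LinearPMap.isSelfAdjoint_def]
  refine LinearPMap.eq_of_eq_graph ?_
  rw [LinearPMap.adjoint_graph_eq_graph_adjoint hd]
  ext ⟨x, y⟩
  rw [Submodule.mem_adjoint_iff, mem_graph_toUnbounded]
  constructor
  · intro h
    refine ⟨x, rfl, ext_inner_left ℂ fun w => ?_⟩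
    have h1 := h w (B w) (mem_graph_toUnbounded.2 ⟨w, rfl, rfl⟩)
    rw [← hB]
    exact sub_eq_zero.1 h1
  · rintro ⟨_, rfl, rfl⟩ a b hab
    obtain ⟨w, rfl, rfl⟩ := mem_graph_toUnbounded.1 hab
    exact sub_eq_zero.2 (hB w _)

/-- An injective compact perturbation of an invertible operator is invertible. -/
theorem isInvertible_add_of_isCompactOperator {G C : E →L[ℂ] E} (hG : G.IsInvertible)
    (hC : IsCompactOperator C) (hinj : ∀ u, G u + C u = 0 → u = 0) : (G + C).IsInvertible := by
  obtain ⟨e, rfl⟩ := hG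
  let S : E →L[ℂ] E := (e.symm : E →L[ℂ] E).comp C
  have hS : IsCompactOperator S := hC.clm_comp (e.symm : E →L[ℂ] E)
  -- Fredholm alternative for `G + C = e (1 + S)` with `S = e⁻¹ C`: an eigenvector of `S` for `-1`
  -- would lie in the kernel of `G + C`.
  rcases hS.hasEigenvalue_or_mem_resolventSet (μ := -1) (by simp) with h | h
  · obtain ⟨u, hu⟩ := h.exists_hasEigenvector
    refine absurd (hinj u ?_) hu.2
    have h1 : e.symm (C u) = (-1 : ℂ) • u := hu.apply_eq_smul
    rw [ContinuousLinearEquiv.symm_apply_eq] at h1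
    simp [h1]
  · rw [spectrum.mem_resolventSet_iff, ContinuousLinearMap.isUnit_iff_bijective] at h
    refine isInvertible_of_bijective ?_
    have h1 : ((e : E →L[ℂ] E) + C : E →L[ℂ] E) =
        (fun x => -e x) ∘ (algebraMap ℂ (E →L[ℂ] E) (-1) - S : E →L[ℂ] E) := by
      funext x
      simp [S, Algebra.algebraMap_eq_smul_one, add_comm]
    rw [h1]
    exact ((Equiv.neg E).bijective.comp e.bijective).comp h

/-- A symmetric Fredholm operator becomes invertible after adding a finite rank operator. -/
theorem exists_isCompactOperator_isInvertible_add {B : E →L[ℂ] E}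
    (hB : ∀ u v, inner ℂ (B u) v = inner ℂ u (B v)) (hF : B.IsFredholm) :
    ∃ P : E →L[ℂ] E, IsCompactOperator P ∧ (B + P).IsInvertible := by
  let N := LinearMap.ker B.toLinearMap
  have hN : FiniteDimensional ℂ N := hF.finite_ker
  have hcl : IsClosed (LinearMap.range B.toLinearMap : Set E) := hF.isClosed_range
  have hR : CompleteSpace (LinearMap.range B.toLinearMap) :=
    IsClosed.completeSpace_coe (s := (LinearMap.range B.toLinearMap : Set E)) (hs := hcl)
  have hNR : Nᗮ = LinearMap.range B.toLinearMap := by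
    rw [← Submodule.orthogonal_orthogonal (LinearMap.range B.toLinearMap),
      orthogonal_range_of_symmetric hB]
  -- For the orthogonal splitting `E = N ⊕ range B`, the operator `B` is bijective on `range B`, and
  -- the projection onto `N = ker B` supplies the identity on `N`.
  refine ⟨N.starProjection, ?_, isInvertible_of_bijective ⟨?_, ?_⟩⟩
  · have : ProperSpace N := FiniteDimensional.proper ℂ N
    exact (isCompactOperator_of_locallyCompactSpace_dom
      N.orthogonalProjectionOnto).clm_comp N.subtypeL
  · rw [injective_iff_map_eq_zero]
    intro u hu
    have hu' : B u + N.starProjection u = 0 := hu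
    have h1 : inner ℂ (N.starProjection u) (B u) = 0 :=
      Submodule.inner_right_of_mem_orthogonal (N.starProjection_apply_mem u)
        (hNR ▸ ⟨u, rfl⟩)
    have h2 : N.starProjection u = 0 := by
      rw [← inner_self_eq_zero (𝕜 := ℂ)]
      nth_rewrite 2 [eq_neg_of_add_eq_zero_right hu']
      rw [inner_neg_right, h1, neg_zero]
    rw [h2, add_zero] at hu'
    have h3 : N.starProjection u = u := Submodule.starProjection_eq_self_iff.2 hu'
    rw [← h3, h2]
  · intro f
    have h1 : f - N.starProjection f ∈ LinearMap.range B.toLinearMap :=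
      hNR ▸ Submodule.sub_starProjection_mem_orthogonal f
    obtain ⟨u, hu⟩ := h1
    -- The preimage `u` of the range component of `f` is freed of its kernel component, which is
    -- replaced by that of `f`.
    refine ⟨u - N.starProjection u + N.starProjection f, ?_⟩
    have hBz : ∀ x, B (N.starProjection x) = 0 := fun x => N.starProjection_apply_mem x
    have hPP : ∀ x, N.starProjection (N.starProjection x) = N.starProjection x := fun x =>
      Submodule.starProjection_eq_self_iff.2 (N.starProjection_apply_mem x)
    change B u = _ at hu
    simp [hBz, hPP, hu]

end BoundedSelfadjoint

/-! ### The form operators and the homotopy of suspensions -/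

section Comparison

variable {X : Type v} {W E H : Type u}
  [NormedAddCommGroup W] [InnerProductSpace ℂ W]
  [NormedAddCommGroup E] [InnerProductSpace ℂ E]
  [NormedAddCommGroup H] [InnerProductSpace ℂ H] [CompleteSpace H]

/-- On the image of `W` this is the symmetry of `A` in `H`; density and continuity do the rest. -/
theorem symmetric_of_form {i : W →L[ℂ] E} {j : E →L[ℂ] H} (hi : DenseRange i)
    {A : W →L[ℂ] H} {hk : Function.Injective (j ∘L i)}
    (hA : IsSelfAdjoint (toUnbounded (j ∘L i) hk A)) {B : E →L[ℂ] E}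
    (hB : ∀ u v : W, inner ℂ (B (i u)) (i v) = inner ℂ (A u) (j (i v))) (u v : E) :
    inner ℂ (B u) v = inner ℂ u (B v) := by
  refine hi.induction_on₂ (p := fun u v => inner ℂ (B u) v = inner ℂ u (B v))
    (isClosed_eq (by fun_prop) (by fun_prop)) (fun a b => ?_) u v
  rw [hB, ← inner_conj_symm (i a), hB, inner_conj_symm]
  exact symm_of_selfadjoint hA a b

variable [CompleteSpace E]

theorem rieszMap_injective {j : E →L[ℂ] H} (hj : DenseRange j) :
    Function.Injective (rieszMap j) := by
  rw [injective_iff_map_eq_zero]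
  intro u hu
  refine hj.eq_zero_of_inner_left ℂ fun v => ?_
  rw [← inner_rieszMap, hu, inner_zero_left]

theorem denseRange_rieszMap {j : E →L[ℂ] H} (hj : Function.Injective j) :
    DenseRange (rieszMap j) := by
  have h : (LinearMap.range (rieszMap j).toLinearMap)ᗮ = ⊥ := by
    rw [eq_bot_iff]
    intro v hv
    rw [Submodule.mem_orthogonal] at hv
    refine hj ?_
    rw [map_zero, ← inner_self_eq_zero (𝕜 := ℂ), ← inner_rieszMap]
    exact hv _ ⟨j v, rfl⟩
  rw [← Submodule.topologicalClosure_eq_top_iff] at h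
  exact (Submodule.dense_iff_topologicalClosure_eq_top).2 h

/-- Both sides have the same inner products with the dense image of `i`. This is the intertwining
relation on which the comparison of `D` and `B` rests. -/
theorem apply_eq_rieszMap {i : W →L[ℂ] E} {j : E →L[ℂ] H} (hi : DenseRange i)
    {A : W →L[ℂ] H} {B : E →L[ℂ] E}
    (hB : ∀ u v : W, inner ℂ (B (i u)) (i v) = inner ℂ (A u) (j (i v))) (u : W) :
    B (i u) = rieszMap j (A u) := by
  refine ext_inner_right ℂ fun v => ?_
  refine hi.induction_on (p := fun v => inner ℂ (B (i u)) v = inner ℂ (rieszMap j (A u)) v) v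
    (isClosed_eq (by fun_prop) (by fun_prop)) fun w => ?_
  rw [hB, inner_rieszMap]

/-- Transversality to an operator in `H` passes to the operator in `E` given by the same form. -/
theorem range_sup_map_rieszMap_eq_top {i : W →L[ℂ] E} {j : E →L[ℂ] H}
    (hj : Function.Injective j) {A : W →L[ℂ] H} {B : E →L[ℂ] E}
    (hAB : ∀ u, B (i u) = rieszMap j (A u)) (hF : B.IsFredholm) (V : Submodule ℂ H)
    [FiniteDimensional ℂ V] (hV : LinearMap.range A.toLinearMap ⊔ V = ⊤) :
    LinearMap.range B.toLinearMap ⊔ V.map (rieszMap j).toLinearMap = ⊤ := by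
  -- Transversality in `H` only shows that the sum contains the range of `rieszMap j`, which is
  -- dense; closedness upgrades this to all of `E`.
  have hcl : IsClosed ((LinearMap.range B.toLinearMap ⊔ V.map (rieszMap j).toLinearMap :
      Submodule ℂ E) : Set E) := by
    exact Submodule.isClosed_sup_finiteDimensional _ _ hF.isClosed_range
  have hle : LinearMap.range (rieszMap j).toLinearMap ≤
      LinearMap.range B.toLinearMap ⊔ V.map (rieszMap j).toLinearMap := by
    rintro _ ⟨f, rfl⟩
    obtain ⟨_, ⟨w, rfl⟩, v, hv, rfl⟩ := Submodule.mem_sup.1 (hV ▸ Submodule.mem_top :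
      f ∈ LinearMap.range A.toLinearMap ⊔ V)
    exact Submodule.mem_sup.2 ⟨_, ⟨i w, hAB w⟩, _, ⟨v, hv, rfl⟩, (map_add _ _ _).symm⟩
  rw [eq_top_iff]
  intro x _
  exact hcl.closure_subset_iff.2 hle (denseRange_rieszMap hj x)

/-- The family `B + i s ((1 - t) K₀ + t)` joining the suspension of `B` by `K₀` to the usual
suspension. -/
noncomputable def suspensionHomotopy (j : E →L[ℂ] H) (B : X → E →L[ℂ] E)
    (p : (X × ℝ) × unitInterval) : E →L[ℂ] E :=
  B p.1.1 + (Complex.I * (p.1.2 : ℂ)) • (((1 - (p.2 : ℝ) : ℝ) : ℂ) • rieszMap j ∘L j +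
    ((p.2 : ℝ) : ℂ) • ContinuousLinearMap.id ℂ E)

theorem suspensionHomotopy_zero (j : E →L[ℂ] H) (B : X → E →L[ℂ] E) (x : X)
    (t : unitInterval) : suspensionHomotopy j B ((x, 0), t) = B x := by
  simp [suspensionHomotopy]

/-- Pair the equation with `u`: the `B`-term is real by symmetry, so the imaginary part `s((1 -
t)‖ju‖² + t‖u‖²)` must vanish. -/
theorem eq_zero_of_suspensionHomotopy {j : E →L[ℂ] H} (hj : Function.Injective j)
    {B : X → E →L[ℂ] E} (hB : ∀ x u v, inner ℂ (B x u) v = inner ℂ u (B x v)) {x : X} {s : ℝ}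
    (hs : s ≠ 0) {t : unitInterval} {u : E} (hu : suspensionHomotopy j B ((x, s), t) u = 0) :
    u = 0 := by
  have him : (inner ℂ u (B x u)).im = 0 := by
    rw [← Complex.conj_eq_iff_im, inner_conj_symm, hB]
  have hK : inner ℂ u (rieszMap j (j u)) = ((‖j u‖ ^ 2 : ℝ) : ℂ) := by
    rw [← inner_conj_symm, inner_rieszMap, inner_self_eq_norm_sq_to_K]
    simp
  have hI : inner ℂ u u = ((‖u‖ ^ 2 : ℝ) : ℂ) := by
    rw [inner_self_eq_norm_sq_to_K]
    simp
  have h1 : (1 - (t : ℝ)) * ‖j u‖ ^ 2 + t * ‖u‖ ^ 2 = 0 := by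
    have h2 := congrArg (inner ℂ u) hu
    have h3 : inner ℂ u (suspensionHomotopy j B ((x, s), t) u) = inner ℂ u (B x u) +
        ((s * ((1 - (t : ℝ)) * ‖j u‖ ^ 2 + t * ‖u‖ ^ 2) : ℝ) : ℂ) * Complex.I := by
      change inner ℂ u (B x u + (Complex.I * (s : ℂ)) • (((1 - (t : ℝ) : ℝ) : ℂ) •
        rieszMap j (j u) + ((t : ℝ) : ℂ) • u)) = _
      rw [inner_add_right, inner_smul_right, inner_add_right, inner_smul_right, inner_smul_right,
        hK, hI]
      push_cast
      ring
    rw [h3, inner_zero_right] at h2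
    have h4 := congrArg Complex.im h2
    rw [Complex.add_im, him, Complex.im_ofReal_mul, Complex.I_im, Complex.zero_im, zero_add,
      mul_one] at h4
    exact (mul_eq_zero.1 h4).resolve_left hs
  have ht0 := t.2.1
  have ht1 := t.2.2
  -- For `t < 1` the term in `‖ju‖²` has a positive coefficient and `j` is injective; for `t = 1`
  -- only `‖u‖²` is left.
  rcases ht1.lt_or_eq with h | h
  · have h2 : ‖j u‖ ^ 2 = 0 := by
      have h3 : 0 ≤ (t : ℝ) * ‖u‖ ^ 2 := by positivity
      have h4 : 0 ≤ ‖j u‖ ^ 2 := by positivity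
      nlinarith
    have h5 : j u = 0 := by simpa using h2
    exact hj (h5.trans (map_zero j).symm)
  · rw [h] at h1
    simpa using h1

/-- Injectivity is known, so it suffices to exhibit the operator as a compact perturbation of an
invertible one; `rieszMap j ∘L j` is compact because `j` is. -/
theorem suspensionHomotopy_isInvertible {j : E →L[ℂ] H} (hj : Function.Injective j)
    (hjc : IsCompactOperator j)
    {B : X → E →L[ℂ] E} (hB : ∀ x u v, inner ℂ (B x u) v = inner ℂ u (B x v))
    (hF : ∀ x, (B x).IsFredholm) {x : X} {s : ℝ} (hs : s ≠ 0) (t : unitInterval) :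
    (suspensionHomotopy j B ((x, s), t)).IsInvertible := by
  have hK : ∀ c : ℂ, IsCompactOperator (c • rieszMap j ∘L j) := fun c =>
    (hjc.clm_comp (rieszMap j)).smul c
  have key : ∀ G C : E →L[ℂ] E, G.IsInvertible → IsCompactOperator C →
      suspensionHomotopy j B ((x, s), t) = G + C →
      (suspensionHomotopy j B ((x, s), t)).IsInvertible := by
    intro G C hG hC h
    rw [h]
    refine isInvertible_add_of_isCompactOperator hG hC fun u hu => ?_
    refine eq_zero_of_suspensionHomotopy hj hB hs (x := x) (t := t) ?_
    rw [h]
    exact hu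
  -- For `t ≠ 0` the invertible part is `B + i(st)`, by selfadjointness of `B`. At `t = 0` this term
  -- is absent, and `B` is instead corrected by a compact operator.
  rcases eq_or_ne (t : ℝ) 0 with ht | ht
  · obtain ⟨P, hP, hBP⟩ := exists_isCompactOperator_isInvertible_add (hB x) (hF x)
    refine key (B x + P) ((Complex.I * (s : ℂ)) • rieszMap j ∘L j - P) hBP
      ((hK _).sub hP) ?_
    simp [suspensionHomotopy, ht]
  · have hk : Function.Injective (ContinuousLinearMap.id ℂ E) := Function.injective_id
    have h := invertible_of_selfadjoint (isSelfAdjoint_toUnbounded_id (hB x) hk)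
      (mul_ne_zero hs ht)
    refine key _ ((Complex.I * (s : ℂ) * ((1 - (t : ℝ) : ℝ) : ℂ)) • rieszMap j ∘L j) h (hK _) ?_
    simp only [suspensionHomotopy, Complex.ofReal_mul, smul_add, smul_smul, mul_assoc]
    abel

/-- Transversality to `suspensionHomotopy` only has to be checked at `s = 0`. -/
theorem isTransversal_suspensionHomotopy {j : E →L[ℂ] H}
    (hj : Function.Injective j) (hjc : IsCompactOperator j) {B : X → E →L[ℂ] E}
    (hB : ∀ x u v, inner ℂ (B x u) v = inner ℂ u (B x v)) (hF : ∀ x, (B x).IsFredholm)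
    {V : Submodule ℂ E} (hV : IsTransversal B V) :
    IsTransversal (suspensionHomotopy j B) V := by
  rintro ⟨⟨x, s⟩, t⟩
  rcases eq_or_ne s 0 with rfl | h
  · rw [suspensionHomotopy_zero]
    exact hV x
  · rw [LinearMap.range_eq_top.2 (suspensionHomotopy_isInvertible hj hjc hB hF h t).surjective,
      top_sup_eq]

variable [TopologicalSpace X]

/-- Only the slice `s = 0` needs an argument about `B`. It is compact, as `X` and the interval are,
and the family there does not depend on `t`. -/
theorem suspensionHomotopy_isFredholmMorphism [CompactSpace X] {j : E →L[ℂ] H}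
    (hj : Function.Injective j) (hjc : IsCompactOperator j) {Y : Set X} {B : X → E →L[ℂ] E}
    (hB : IsSelfadjointFredholmFamily (ContinuousLinearMap.id ℂ E) Y B) :
    IsFredholmMorphism ((Y ×ˢ Set.univ) ×ˢ Set.univ) (suspensionHomotopy j B) := by
  have hsym : ∀ x u v, inner ℂ (B x u) v = inner ℂ u (B x v) := fun x =>
    symm_of_selfadjoint (hB.selfadjoint x)
  have hs : ∀ x (s : ℝ) t, s ≠ 0 → (suspensionHomotopy j B ((x, s), t)).IsInvertible :=
    fun x s t h => suspensionHomotopy_isInvertible hj hjc hsym hB.fredholm h t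
  refine ⟨?_, ?_, ?_, ?_, ?_⟩
  · unfold suspensionHomotopy
    have := hB.continuous
    fun_prop
  · rintro ⟨⟨x, s⟩, t⟩
    rcases eq_or_ne s 0 with rfl | h
    · rw [suspensionHomotopy_zero]
      exact hB.fredholm x
    · obtain ⟨e, he⟩ := hs x s t h
      rw [← he]
      exact ContinuousLinearMap.IsFredholm.of_isQuasiInverse
        (v := (e.symm : E →L[ℂ] E)) e.toLinearEquiv.isQuasiInverse
  · rintro ⟨⟨x, s⟩, t⟩
    rcases eq_or_ne s 0 with rfl | h
    · rw [suspensionHomotopy_zero]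
      exact index_eq_zero_of_selfadjoint (hB.selfadjoint x) (hB.fredholm x)
    · obtain ⟨e, he⟩ := hs x s t h
      rw [← he]
      exact LinearEquiv.index_eq_zero (e := e.toLinearEquiv)
  · refine ⟨(Set.univ ×ˢ {0}) ×ˢ Set.univ,
      (isCompact_univ.prod isCompact_singleton).prod isCompact_univ, ?_⟩
    rintro ⟨⟨x, s⟩, t⟩ hx
    exact hs x s t (by simpa using hx)
  · rintro ⟨⟨x, s⟩, t⟩ ⟨⟨hx, -⟩, -⟩
    rcases eq_or_ne s 0 with rfl | h
    · rw [suspensionHomotopy_zero]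
      exact hB.invertible_on x hx
    · exact hs x s t h

/-- Invertibility on `Y` is the case `V = 0` of transversality: `D x` onto gives `B x` onto, and by
symmetry the kernel of `B x` is the orthogonal complement of its range. -/
theorem isSelfadjointFredholmFamily_of_form {Y : Set X} {i : W →L[ℂ] E} {j : E →L[ℂ] H}
    (hj : Function.Injective j) (hi : DenseRange i) {D : X → W →L[ℂ] H}
    (hD : IsSelfadjointFredholmFamily (j ∘L i) Y D) {B : X → E →L[ℂ] E}
    (hB : ∀ (x : X) (u v : W), inner ℂ (B x (i u)) (i v) = inner ℂ (D x u) (j (i v)))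
    (hBcont : Continuous B) (hBfred : ∀ x, (B x).IsFredholm) :
    IsSelfadjointFredholmFamily (ContinuousLinearMap.id ℂ E) Y B := by
  have hsym : ∀ x u v, inner ℂ (B x u) v = inner ℂ u (B x v) := fun x =>
    symmetric_of_form hi (hD.selfadjoint x) (hB x)
  refine ⟨Function.injective_id, Function.surjective_id.denseRange, hBcont,
    fun x => isSelfAdjoint_toUnbounded_id (hsym x) _, hBfred, fun x hx => ?_⟩
  have h := range_sup_map_rieszMap_eq_top hj (apply_eq_rieszMap hi (hB x)) (hBfred x) ⊥
    (by rw [LinearMap.range_eq_top.2 (hD.invertible_on x hx).surjective, top_sup_eq])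
  rw [Submodule.map_bot, sup_bot_eq] at h
  refine isInvertible_of_bijective ⟨?_, LinearMap.range_eq_top.1 h⟩
  refine LinearMap.ker_eq_bot.1 ((orthogonal_range_of_symmetric (hsym x)).symm.trans ?_)
  rw [h, Submodule.top_orthogonal_eq_bot]

end Comparison

end IndexBundle

theorem theorem2p3
    {X : Type v} [TopologicalSpace X] [CompactSpace X] (Y : Set X) (hY : IsClosed Y)
    {W E H : Type u}
    [NormedAddCommGroup W] [InnerProductSpace ℂ W] [CompleteSpace W]
    [NormedAddCommGroup E] [InnerProductSpace ℂ E] [CompleteSpace E]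
    [NormedAddCommGroup H] [InnerProductSpace ℂ H] [CompleteSpace H]
    (i : W →L[ℂ] E) (hi : Function.Injective i)
    (j : E →L[ℂ] H) (hj : Function.Injective j) (hjc : IsCompactOperator j)
    (hWH : DenseRange (j ∘L i)) (hWE : DenseRange i)
    (hWK : Set.range i ⊆ Set.range (IndexBundle.rieszMap j))
    (D : X → W →L[ℂ] H) (hD : IndexBundle.IsSelfadjointFredholmFamily (j ∘L i) Y D)
    (C : ℝ) (hC : 0 < C)
    (hbound : ∀ (x : X) (u v : W), ‖inner ℂ (D x u) (j (i v))‖ ≤ C * ‖i u‖ * ‖i v‖)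
    (B : X → E →L[ℂ] E)
    (hB : ∀ (x : X) (u v : W), inner ℂ (B x (i u)) (i v) = inner ℂ (D x u) (j (i v)))
    (hBcont : Continuous B) (hBfred : ∀ x, (B x).IsFredholm)
    (hker : ∀ (x : X) (s : ℝ) (u : E),
      B x u + (Complex.I * (s : ℂ)) • IndexBundle.rieszMap j (j u) = 0 → u ∈ Set.range i) :
    ∃ hBfam : IndexBundle.IsSelfadjointFredholmFamily (ContinuousLinearMap.id ℂ E) Y B,
      IndexBundle.sind hD = IndexBundle.sind hBfam := by
  open IndexBundle in
  have hBfam := isSelfadjointFredholmFamily_of_form hj hWE hD hB hBcont hBfred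
  refine ⟨hBfam, ?_⟩
  have hsym : ∀ x u v, inner ℂ (B x u) v = inner ℂ u (B x v) := fun x =>
    symm_of_selfadjoint (hBfam.selfadjoint x)
  have hjd : DenseRange j := hWH.mono (Set.range_comp_subset_range i j)
  have hDs := suspension_isFredholmMorphism hD
  have hBs := suspension_isFredholmMorphism hBfam
  have hT := suspensionHomotopy_isFredholmMorphism hj hjc hBfam
  have hT₀ : IsFredholmMorphism (Y ×ˢ Set.univ) fun z => suspensionHomotopy j B (z, 0) := by
    obtain ⟨h1, h2, h3, -, h5⟩ := hT
    refine ⟨h1.comp (by fun_prop), fun z => h2 _, fun z => h3 _,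
      ⟨Set.univ ×ˢ {0}, isCompact_univ.prod isCompact_singleton, ?_⟩,
      fun z hz => h5 _ ⟨hz, trivial⟩⟩
    rintro ⟨x, s⟩ hx
    exact suspensionHomotopy_isInvertible hj hjc hsym hBfred (by simpa using hx) 0
  -- The two indices are formed with unrelated chosen subspaces of `H` and of `E`, so the classes
  -- are compared for arbitrary ones.
  suffices key : ∀ (V : Submodule ℂ H) (_ : FiniteDimensional ℂ V)
      (hV : IsTransversal (suspension (j ∘L i) D) V) (V' : Submodule ℂ E)
      (_ : FiniteDimensional ℂ V')
      (hV' : IsTransversal (suspension (ContinuousLinearMap.id ℂ E) B) V'),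
      indexClass hDs V hV = indexClass hBs V' hV' from
    key _ (exists_transversal hDs).choose_spec.1 (exists_transversal hDs).choose_spec.2
      _ (exists_transversal hBs).choose_spec.1 (exists_transversal hBs).choose_spec.2
  intro V hfin hV V' hfin' hV'
  have hVB : IsTransversal B (V.map (rieszMap j).toLinearMap) := by
    intro x
    refine range_sup_map_rieszMap_eq_top hj (apply_eq_rieszMap hWE (hB x)) (hBfred x) V ?_
    have := hV (x, 0)
    simpa [suspension] using this
  have hVB' : IsTransversal B V' := by
    intro x
    have := hV' (x, 0)
    simpa [suspension] using this
  have htV := isTransversal_suspensionHomotopy hj hjc hsym hBfred hVB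
  have htV' := isTransversal_suspensionHomotopy hj hjc hsym hBfred hVB'
  have hone : ∀ z, suspensionHomotopy j B (z, 1) = suspension (ContinuousLinearMap.id ℂ E) B z :=
    fun z => by simp [suspensionHomotopy, suspension]
  -- The intertwining leads from `(D + is, V)` to the `t = 0` end of the homotopy with the image of
  -- `V` under `rieszMap j`; the homotopy then leads to `(B + is, V')`, changing the subspace on the
  -- way.
  refine (indexClass_eq_of_intertwining hDs hT₀ i (rieszMap j) hi (rieszMap_injective hjd) ?_ V hV
    (fun z => htV (z, 0))).trans (indexClass_eq_of_homotopy hT _ V' htV htV' hT₀ hBs (fun z => rfl)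
    hone _ hV')
  rintro ⟨x, s⟩ w
  simp [suspensionHomotopy, suspension, apply_eq_rieszMap hWE (hB x)]
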